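/- Let $s=(s_n)_{n\ge0}$ be a real sequence with $s_0=1$, and let $V$ be the set of positive Borel measures on $\mathbb R$ that have moments of every order and satisfy $\int x^n\,d\mu(x)=s_n$ for all $n\ge 0$. Assume that $s$ is an indeterminate Stieltjes moment sequence (indet(S)), i.e. that more than one $\mu\in V$ is supported by $[0,\infty)$. Let $(P_n)$ be the orthonormal polynomials of $s$ (with $\deg P_n=n$ and positive leading coefficients). Put $a_n=\int xP_n^2\,d\mu$ and $b_n=\int xP_nP_{n+1}\,d\mu$ for $\mu\in V$. Let $(Q_n)$ be the polynomials of the second kind, given by $Q_0=0$, $Q_1=1/b_0$ and $xQ_n=b_nQ_{n+1}+a_nQ_n+b_{n-1}Q_{n-1}$ for $n\ge1$. Then $\sum_k|P_k(z)|^2<\infty$ and $\sum_k|Q_k(z)|^2<\infty$ for every $z\in\mathbb C$, so that $$A(z)=z\sum_{k\ge0}Q_k(z)Q_k(0),\qquad B(z)=-1+z\sum_{k\ge0}P_k(z)Q_k(0),$$ $$C(z)=1+z\sum_{k\ge0}Q_k(z)P_k(0),\qquad D(z)=z\sum_{k\ge0}P_k(z)P_k(0)$$ are well defined on $\mathbb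 C$, and the limits $$\alpha(s)=\lim_{n\to\infty}\frac{P_n(0)}{Q_n(0)}=\lim_{x\to-\infty}\frac{D(x)}{B(x)}\in\mathbb R$$ exist and agree. Let $x_{n,1}<\dots<x_{n,n}$ be the zeros of $P_n$. Then for every $k\ge1$ the limit $\xi_k=\lim_{n\to\infty}x_{n,k}$ exists, and $0<\xi_1<\xi_2<\cdots$ with $\xi_k\to\infty$. The function $B(z)\alpha(s)-D(z)$ is entire, and its set of zeros in $\mathbb C$ is exactly $\{\xi_k: k\ge1\}$. There is exactly one measure $\nu_{\alpha(s)}\in V$ (the Friedrichs solution) with $$\int\frac{d\nu_{\alpha(s)}(x)}{x-z}=-\frac{A(z)\alpha(s)-C(z)}{B(z)\alpha(s)-D(z)},\qquad z\in\mathbb C\setminus\mathbb R,$$ and its support is $\{\xi_k: k\ge1\}$. -/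

import Mathlib

open Polynomial Filter Topology MeasureTheory

noncomputable section

namespace StieltjesMoment

/-- `μ` solves the Hamburger moment problem for `s`: all moments of `μ` exist and are the `s n`. -/
def IsSolution (s : ℕ → ℝ) (μ : Measure ℝ) : Prop :=
  ∀ n : ℕ, Integrable (fun x : ℝ => x ^ n) μ ∧ ∫ x, x ^ n ∂μ = s n

/-- `indet(S)`: there is more than one solution supported by the half-line `[0, ∞)`. -/
def IndetS (s : ℕ → ℝ) : Prop :=
  ∃ μ₁ μ₂ : Measure ℝ, IsSolution s μ₁ ∧ IsSolution s μ₂ ∧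
    μ₁ (Set.Iio 0) = 0 ∧ μ₂ (Set.Iio 0) = 0 ∧ μ₁ ≠ μ₂

/-- The moment functional: the linear functional on `ℝ[X]` sending `X ^ n` to `s n`; it is
`p ↦ ∫ p dμ` for every solution `μ`. -/
def momentFun (s : ℕ → ℝ) (p : ℝ[X]) : ℝ :=
  p.sum fun n c => c * s n

/-- `q` divided by its norm with respect to the inner product `(p, q) ↦ momentFun s (p * q)`. -/
def normalizePoly (s : ℕ → ℝ) (q : ℝ[X]) : ℝ[X] :=
  C (√(momentFun s (q * q)))⁻¹ * q

/-- The orthonormal polynomials `P n`, obtained by the Gram-Schmidt process from `1, X, X ^ 2, …`;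
the leading coefficients are positive. -/
def P (s : ℕ → ℝ) (n : ℕ) : ℝ[X] :=
  normalizePoly s (X ^ n - ∑ k : Fin n, C (momentFun s (X ^ n * P s k)) * P s k)
termination_by n
decreasing_by exact k.2

/-- The diagonal Jacobi parameters `a n = ∫ x P_n(x)² dμ(x)`. -/
def jacobiA (s : ℕ → ℝ) (n : ℕ) : ℝ := momentFun s (X * P s n ^ 2)

/-- The off-diagonal Jacobi parameters `b n = ∫ x P_n(x) P_{n+1}(x) dμ(x)`. -/
def jacobiB (s : ℕ → ℝ) (n : ℕ) : ℝ := momentFun s (X * P s n * P s (n + 1))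

/-- The polynomials of the second kind: `Q 0 = 0`, `Q 1 = 1 / b 0` and
`x Q_n = b_n Q_{n+1} + a_n Q_n + b_{n-1} Q_{n-1}` for `n ≥ 1`. -/
def Q (s : ℕ → ℝ) : ℕ → ℝ[X]
  | 0 => 0
  | 1 => C (1 / jacobiB s 0)
  | n + 2 => C (1 / jacobiB s (n + 1)) *
      ((X - C (jacobiA s (n + 1))) * Q s (n + 1) - C (jacobiB s n) * Q s n)

/-- The Nevanlinna function `A(z) = A(z, 0)`. -/
def nevA (s : ℕ → ℝ) (z : ℂ) : ℂ := z * ∑' k : ℕ, aeval z (Q s k) * aeval (0 : ℂ) (Q s k)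

/-- The Nevanlinna function `B(z) = B(z, 0)`. -/
def nevB (s : ℕ → ℝ) (z : ℂ) : ℂ := -1 + z * ∑' k : ℕ, aeval z (P s k) * aeval (0 : ℂ) (Q s k)

/-- The Nevanlinna function `C(z) = C(z, 0)`. -/
def nevC (s : ℕ → ℝ) (z : ℂ) : ℂ := 1 + z * ∑' k : ℕ, aeval z (Q s k) * aeval (0 : ℂ) (P s k)

/-- The Nevanlinna function `D(z) = D(z, 0)`. -/
def nevD (s : ℕ → ℝ) (z : ℂ) : ℂ := z * ∑' k : ℕ, aeval z (P s k) * aeval (0 : ℂ) (P s k)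

/-- `α(s) = lim P_n(0) / Q_n(0)`. -/
def alpha (s : ℕ → ℝ) : ℝ :=
  limUnder atTop fun n : ℕ => (P s n).eval 0 / (Q s n).eval 0

/-- `x_{n,k+1}`: the zeros of `P n` in increasing order, the index `k` starting at `0`
(the value is a dummy `0` for `k ≥ n`). -/
def polyZero (s : ℕ → ℝ) (n k : ℕ) : ℝ :=
  ((P s n).roots.sort (· ≤ ·)).getD k 0

/-- `ξ_{k+1} = lim_n x_{n,k+1}`, the index `k` starting at `0`. -/
def xi (s : ℕ → ℝ) (k : ℕ) : ℝ :=
  limUnder atTop fun n : ℕ => polyZero s n k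

/-- `ν` is the N-extremal solution `ν_t`, `t ∈ ℝ`. -/
def IsNExtremal (s : ℕ → ℝ) (t : ℝ) (ν : Measure ℝ) : Prop :=
  IsSolution s ν ∧ ∀ z : ℂ, z.im ≠ 0 →
    ∫ x : ℝ, ((x : ℂ) - z)⁻¹ ∂ν = -((nevA s z * t - nevC s z) / (nevB s z * t - nevD s z))

/-- `ν` is the Friedrichs solution `ν_{α(s)}`. -/
def IsFriedrichs (s : ℕ → ℝ) (ν : Measure ℝ) : Prop :=
  IsNExtremal s (alpha s) ν

end StieltjesMoment

end

/-! Indeterminacy enters in two ways. First, two distinct solutions on the half-line have different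
Stieltjes transforms `w₁ ≠ w₂` at some non-real `z`. The functions of the second kind `Q_n(z) + w_i
P_n(z)` are the coefficients of `(t - z)⁻¹` in two L² spaces, hence square summable by Bessel;
eliminating gives `P_n(z)` and `Q_n(z)` in ℓ². Variation of constants and a discrete Gronwall
inequality carry this to every point of the plane, locally uniformly (`exists_dominated`). The
Nevanlinna functions are then limits of Casorati determinants, even along moving arguments, and
variation of constants based at `0` gives `-P_{n+1}(z_n)/Q_{n+1}(0) → B(z)α - D(z)` whenever `z_n →
z`, likewise for `Q`, `A`, `C` (`tendsto_P_div`, `tendsto_Q_div`).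

Second, `α < 0` (`alpha_neg`): on the negative axis the Stieltjes transforms of half-line solutions
are squeezed between two rational functions whose gap tends to `0` if `α = 0`, which would force
uniqueness.

The zeros of `P_n` are simple, positive and interlacing, so the `k`-th one decreases to some `ξ_k`,
and inserting these zeros as `z_n` makes `ξ_k` a zero of `Bα - D`. The kernel `K(x, y) = ∑ P_k(x)
P_k(y)` vanishes at pairs of distinct zeros of `P_n`, hence at `(ξ_i, ξ_j)` for `i ≠ j`, while `K(x,
x) ≥ 1`; this forbids coincidences and finite accumulation. The value `-α` of `Bα - D` at `0`
forbids `ξ_k = 0`. There are no other zeros: by Gauss quadrature `-Q_n/P_n` is the Stieltjes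
transform of a probability measure on the zeros of `P_n`, so `|Aα - C| ≤ δ⁻¹ |Bα - D|` at any point
different from all `ξ_k`, and both cannot vanish since `AD - BC = 1`.

The Gauss measures converge termwise to the measure with mass `1/K(ξ_j, ξ_j)` at `ξ_j`. Because `ξ_J
→ ∞`, one extra moment makes the tails uniformly small, so moments and Stieltjes transforms pass to
the limit (`tendsto_quadrature`). Uniqueness holds because mass and Stieltjes transform determine a
finite measure (`measure_ext_of_stieltjes`). -/

namespace StieltjesMoment

/-! ### The moment functional and the orthonormal polynomials -/

/-- The moment functional as a linear map. -/
noncomputable def momentLin (s : ℕ → ℝ) : ℝ[X] →ₗ[ℝ] ℝ :=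
  Polynomial.lsum fun n => s n • LinearMap.id

theorem momentFun_eq (s : ℕ → ℝ) (p : ℝ[X]) : momentFun s p = momentLin s p := by
  simp [momentFun, momentLin, Polynomial.lsum_apply, mul_comm]

theorem momentFun_C_mul (s : ℕ → ℝ) (c : ℝ) (p : ℝ[X]) :
    momentFun s (C c * p) = c * momentFun s p := by
  rw [momentFun_eq, momentFun_eq, ← smul_eq_C_mul, map_smul, smul_eq_mul]

theorem momentFun_sub (s : ℕ → ℝ) (p q : ℝ[X]) :
    momentFun s (p - q) = momentFun s p - momentFun s q := by
  simp only [momentFun_eq, map_sub]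

theorem momentFun_sum (s : ℕ → ℝ) {ι : Type*} (S : Finset ι) (f : ι → ℝ[X]) :
    momentFun s (∑ i ∈ S, f i) = ∑ i ∈ S, momentFun s (f i) := by
  simp only [momentFun_eq, map_sum]

theorem momentFun_X_pow (s : ℕ → ℝ) (n : ℕ) : momentFun s (X ^ n) = s n := by
  rw [momentFun, ← monomial_one_right_eq_X_pow, sum_monomial_index] <;> simp

theorem momentFun_one (s : ℕ → ℝ) : momentFun s 1 = s 0 := by
  simpa using momentFun_X_pow s 0

/-- The moment functional is positive definite. -/
def PosDef (s : ℕ → ℝ) : Prop := ∀ p : ℝ[X], p ≠ 0 → 0 < momentFun s (p * p)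

variable {s : ℕ → ℝ}

/-- Gram-Schmidt. The four claims share one strong induction, since orthogonality at `n` uses
degree, norm and orthogonality below `n`; positive definiteness keeps the normalizing factor
nonzero. -/
theorem P_spec (hp : PosDef s) (n : ℕ) :
    (P s n).degree = n ∧ 0 < (P s n).leadingCoeff ∧ momentFun s (P s n * P s n) = 1 ∧
      ∀ k < n, momentFun s (P s n * P s k) = 0 := by
  induction n using Nat.strong_induction_on with
  | _ n ih =>
    set q : ℝ[X] := X ^ n - ∑ k : Fin n, C (momentFun s (X ^ n * P s k)) * P s k with hq
    have hdeg : (∑ k : Fin n, C (momentFun s (X ^ n * P s k)) * P s k).degree < n := by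
      refine (degree_sum_le _ _).trans_lt ?_
      rw [Finset.sup_lt_iff (by exact WithBot.bot_lt_coe n)]
      intro k _
      rw [← smul_eq_C_mul]
      refine (degree_smul_le _ _).trans_lt ?_
      rw [(ih k k.2).1]
      exact_mod_cast k.2
    have hmonic : q.Monic := monic_X_pow_sub hdeg
    have hqdeg : q.degree = n := by
      rw [hq, degree_sub_eq_left_of_degree_lt] <;> simp only [degree_X_pow]
      exact hdeg
    have hLq := hp q hmonic.ne_zero
    have hsq : 0 < √(momentFun s (q * q)) := Real.sqrt_pos.2 hLq
    have hP : P s n = C (√(momentFun s (q * q)))⁻¹ * q := by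
      rw [P, normalizePoly]
    have horth : ∀ j < n, momentFun s (q * P s j) = 0 := by
      intro j hj
      rw [hq, sub_mul, momentFun_sub, Finset.sum_mul, momentFun_sum,
        Finset.sum_eq_single (⟨j, hj⟩ : Fin n)]
      · rw [mul_assoc, momentFun_C_mul, (ih j hj).2.2.1]; simp
      · intro k _ hk
        have hkj : (k : ℕ) ≠ j := fun h => hk (Fin.ext h)
        rw [mul_assoc, momentFun_C_mul]
        rcases lt_or_gt_of_ne hkj with h | h
        · rw [mul_comm (P s k), (ih j hj).2.2.2 k h, mul_zero]
        · rw [(ih k k.2).2.2.2 j h, mul_zero]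
      · simp
    refine ⟨?_, ?_, ?_, ?_⟩
    · rw [hP, degree_C_mul (inv_ne_zero hsq.ne'), hqdeg]
    · rw [hP, leadingCoeff_mul, leadingCoeff_C, hmonic.leadingCoeff, mul_one]
      exact inv_pos.2 hsq
    · rw [hP, show C (√(momentFun s (q * q)))⁻¹ * q * (C (√(momentFun s (q * q)))⁻¹ * q) =
        C (√(momentFun s (q * q)))⁻¹ * (C (√(momentFun s (q * q)))⁻¹ * (q * q)) by ring,
        momentFun_C_mul, momentFun_C_mul]
      field_simp
      rw [Real.sq_sqrt hLq.le]
    · intro k hk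
      rw [hP, mul_assoc, momentFun_C_mul, horth k hk, mul_zero]

theorem degree_P (hp : PosDef s) (n : ℕ) : (P s n).degree = n := (P_spec hp n).1

theorem natDegree_P (hp : PosDef s) (n : ℕ) : (P s n).natDegree = n :=
  natDegree_eq_of_degree_eq_some (degree_P hp n)

theorem leadingCoeff_P_pos (hp : PosDef s) (n : ℕ) : 0 < (P s n).leadingCoeff := (P_spec hp n).2.1

theorem P_ne_zero (hp : PosDef s) (n : ℕ) : P s n ≠ 0 :=
  leadingCoeff_ne_zero.1 (leadingCoeff_P_pos hp n).ne'

theorem momentFun_P_mul_P (hp : PosDef s) (m n : ℕ) :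
    momentFun s (P s m * P s n) = if m = n then 1 else 0 := by
  rcases lt_trichotomy m n with h | h | h
  · rw [mul_comm, (P_spec hp n).2.2.2 m h, if_neg h.ne]
  · rw [h, (P_spec hp n).2.2.1, if_pos rfl]
  · rw [(P_spec hp m).2.2.2 n h, if_neg h.ne']

theorem exists_expansion (hp : PosDef s) (n : ℕ) : ∀ q : ℝ[X], q.degree < n →
    ∃ c : ℕ → ℝ, q = ∑ k ∈ Finset.range n, C (c k) * P s k := by
  induction n with
  | zero =>
    intro q hq
    exact ⟨0, by simpa [Nat.WithBot.lt_zero_iff] using hq⟩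
  | succ n ih =>
    intro q hq
    have hlc := leadingCoeff_P_pos hp n
    have hcoeff : (P s n).coeff n = (P s n).leadingCoeff := by
      rw [leadingCoeff, natDegree_P hp]
    have hd : (q - C (q.coeff n / (P s n).leadingCoeff) * P s n).degree < n := by
      rw [degree_lt_iff_coeff_zero] at hq ⊢
      intro m hm
      rw [coeff_sub, coeff_C_mul]
      rcases hm.eq_or_lt with rfl | h
      · rw [hcoeff, div_mul_cancel₀ _ hlc.ne', sub_self]
      · rw [hq m h, coeff_eq_zero_of_natDegree_lt (p := P s n) (by rwa [natDegree_P hp])]; simp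
    obtain ⟨c, hc⟩ := ih _ hd
    refine ⟨Function.update c n (q.coeff n / (P s n).leadingCoeff), ?_⟩
    rw [Finset.sum_range_succ, Function.update_self, ← sub_eq_iff_eq_add, hc]
    refine Finset.sum_congr rfl fun k hk => ?_
    rw [Function.update_of_ne (Finset.mem_range.1 hk).ne]

theorem expansion (hp : PosDef s) {n : ℕ} {q : ℝ[X]} (hq : q.degree < n) :
    q = ∑ k ∈ Finset.range n, C (momentFun s (q * P s k)) * P s k := by
  obtain ⟨c, hc⟩ := exists_expansion hp n q hq
  conv_lhs => rw [hc]
  refine Finset.sum_congr rfl fun j hj => ?_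
  congr 2
  rw [hc, Finset.sum_mul, momentFun_sum, Finset.sum_eq_single j]
  · rw [mul_assoc, momentFun_C_mul, momentFun_P_mul_P hp, if_pos rfl, mul_one]
  · intro k _ hk
    rw [mul_assoc, momentFun_C_mul, momentFun_P_mul_P hp, if_neg hk, mul_zero]
  · exact fun h => absurd hj h

theorem momentFun_mul_P_eq_zero (hp : PosDef s) {n : ℕ} {q : ℝ[X]} (hq : q.degree < n) :
    momentFun s (q * P s n) = 0 := by
  rw [expansion hp hq, Finset.sum_mul, momentFun_sum]
  refine Finset.sum_eq_zero fun k hk => ?_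
  rw [mul_assoc, momentFun_C_mul, momentFun_P_mul_P hp, if_neg (Finset.mem_range.1 hk).ne, mul_zero]

/-! ### The three-term recurrence -/

theorem momentFun_X_mul_P_mul_P (hp : PosDef s) {m n : ℕ} (h : m + 1 < n) :
    momentFun s (X * P s m * P s n) = 0 := by
  refine momentFun_mul_P_eq_zero hp ?_
  rw [degree_mul, degree_X, degree_P hp, add_comm]
  exact_mod_cast h

theorem degree_X_mul_P (hp : PosDef s) (n : ℕ) : (X * P s n).degree < ((n + 2 : ℕ) : WithBot ℕ) := by
  rw [degree_mul, degree_X, degree_P hp, add_comm]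
  exact_mod_cast Nat.lt_succ_self (n + 1)

theorem X_mul_P_zero (hp : PosDef s) :
    X * P s 0 = C (jacobiB s 0) * P s 1 + C (jacobiA s 0) * P s 0 := by
  conv_lhs => rw [expansion hp (degree_X_mul_P hp 0)]
  rw [Finset.sum_range_succ, Finset.sum_range_one, jacobiA, jacobiB, sq, mul_assoc X (P s 0) (P s 0)]
  ring

theorem X_mul_P_succ (hp : PosDef s) (n : ℕ) :
    X * P s (n + 1) = C (jacobiB s (n + 1)) * P s (n + 2) + C (jacobiA s (n + 1)) * P s (n + 1) +
      C (jacobiB s n) * P s n := by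
  conv_lhs => rw [expansion hp (degree_X_mul_P hp (n + 1))]
  rw [Finset.sum_range_succ, Finset.sum_range_succ, Finset.sum_range_succ, Finset.sum_eq_zero]
  · rw [jacobiA, jacobiB, jacobiB, sq, mul_assoc X (P s (n + 1)) (P s (n + 1)),
      mul_right_comm X (P s n)]
    ring
  · intro k hk
    rw [mul_right_comm, momentFun_X_mul_P_mul_P hp (by simpa using hk)]
    simp

theorem jacobiB_pos (hp : PosDef s) (n : ℕ) : 0 < jacobiB s n := by
  -- Comparison of the coefficients of `X ^ (n + 1)` in the recurrence.
  have key : (P s n).leadingCoeff = jacobiB s n * (P s (n + 1)).leadingCoeff := by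
    have h1 : (X * P s n).coeff (n + 1) = (P s n).leadingCoeff := by
      rw [coeff_X_mul, leadingCoeff, natDegree_P hp]
    have h2 : ∀ k ≤ n, (P s k).coeff (n + 1) = 0 := fun k hk =>
      coeff_eq_zero_of_natDegree_lt (by rw [natDegree_P hp]; omega)
    have h3 : (P s (n + 1)).coeff (n + 1) = (P s (n + 1)).leadingCoeff := by
      rw [leadingCoeff, natDegree_P hp]
    cases n with
    | zero =>
      rw [← h1, X_mul_P_zero hp, coeff_add, coeff_C_mul, coeff_C_mul, h2 0 le_rfl, h3]; simp
    | succ n =>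
      rw [← h1, X_mul_P_succ hp, coeff_add, coeff_add, coeff_C_mul, coeff_C_mul, coeff_C_mul,
        h2 (n + 1) le_rfl, h2 n (by omega), h3]; simp
  have := leadingCoeff_P_pos hp n
  rw [key] at this
  exact pos_of_mul_pos_left this (leadingCoeff_P_pos hp (n + 1)).le

theorem P_zero (hs0 : s 0 = 1) : P s 0 = 1 := by
  rw [P, normalizePoly]
  simp [momentFun_one, hs0]

end StieltjesMoment

namespace StieltjesMoment

/-! ### Solutions of the three-term recurrence -/

section Recurrence

variable {s : ℕ → ℝ} {K : Type*} [Field K] [Algebra ℝ K]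

/-- `f` solves the three-term recurrence with spectral parameter `z`, from index `1` on. -/
def IsRec (s : ℕ → ℝ) (z : K) (f : ℕ → K) : Prop :=
  ∀ n, z * f (n + 1) = algebraMap ℝ K (jacobiB s (n + 1)) * f (n + 2) +
    algebraMap ℝ K (jacobiA s (n + 1)) * f (n + 1) + algebraMap ℝ K (jacobiB s n) * f n

/-- The Casorati determinant `b_n (f_{n+1} g_n - f_n g_{n+1})`. -/
noncomputable def casorati (s : ℕ → ℝ) (n : ℕ) (f g : ℕ → K) : K :=
  algebraMap ℝ K (jacobiB s n) * (f (n + 1) * g n - f n * g (n + 1))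

/-- Green's formula: the Casorati determinants telescope. The index `0` term is corrected separately
because `IsRec` says nothing there, and `Q` in fact violates the homogeneous recurrence at `0`. -/
theorem IsRec.sum {z w : K} {f g : ℕ → K} (hf : IsRec s z f) (hg : IsRec s w g) (n : ℕ) :
    (z - w) * ∑ k ∈ Finset.range (n + 1), f k * g k =
      casorati s n f g - casorati s 0 f g + (z - w) * (f 0 * g 0) := by
  induction n with
  | zero => simp
  | succ n ih =>
    rw [Finset.sum_range_succ, mul_add, ih]
    simp only [casorati]
    linear_combination g (n + 1) * hf n - f (n + 1) * hg n

theorem isRec_P (hp : PosDef s) (z : K) : IsRec s z fun k => aeval z (P s k) := by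
  intro n
  have := congrArg (aeval z) (X_mul_P_succ hp n)
  simpa using this

theorem algebraMap_jacobiB_ne_zero (hp : PosDef s) (n : ℕ) :
    algebraMap ℝ K (jacobiB s n) ≠ 0 := by
  rw [Ne, map_eq_zero]
  exact (jacobiB_pos hp n).ne'

theorem isRec_Q (hp : PosDef s) (z : K) : IsRec s z fun k => aeval z (Q s k) := by
  intro n
  have h := algebraMap_jacobiB_ne_zero (K := K) hp (n + 1)
  simp only [Q, map_mul, map_sub, aeval_C, aeval_X, map_div₀, map_one]
  field_simp
  ring

theorem aeval_P_zero (hs0 : s 0 = 1) (z : K) : aeval z (P s 0) = 1 := by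
  rw [P_zero hs0, map_one]

theorem aeval_Q_zero (z : K) : aeval z (Q s 0) = 0 := by
  rw [Q, map_zero]

theorem jacobiB_mul_aeval_P_one (hp : PosDef s) (hs0 : s 0 = 1) (z : K) :
    algebraMap ℝ K (jacobiB s 0) * aeval z (P s 1) = z - algebraMap ℝ K (jacobiA s 0) := by
  have := congrArg (aeval z) (X_mul_P_zero hp)
  simp only [map_mul, aeval_X, map_add, aeval_C, aeval_P_zero hs0, mul_one] at this
  linear_combination -this

theorem jacobiB_mul_aeval_Q_one (hp : PosDef s) (z : K) :
    algebraMap ℝ K (jacobiB s 0) * aeval z (Q s 1) = 1 := by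
  have h := algebraMap_jacobiB_ne_zero (K := K) hp 0
  rw [Q, aeval_C, map_div₀, map_one]
  field_simp

/-- The Christoffel-Darboux formula. -/
theorem casorati_P_P (hp : PosDef s) (hs0 : s 0 = 1) (z w : K) (n : ℕ) :
    casorati s n (fun k => aeval z (P s k)) (fun k => aeval w (P s k)) =
      (z - w) * ∑ k ∈ Finset.range (n + 1), aeval z (P s k) * aeval w (P s k) := by
  rw [(isRec_P hp z).sum (isRec_P hp w)]
  simp only [casorati, aeval_P_zero hs0, zero_add]
  linear_combination jacobiB_mul_aeval_P_one hp hs0 z - jacobiB_mul_aeval_P_one hp hs0 w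

theorem casorati_P_Q (hp : PosDef s) (hs0 : s 0 = 1) (z w : K) (n : ℕ) :
    casorati s n (fun k => aeval z (P s k)) (fun k => aeval w (Q s k)) =
      -1 + (z - w) * ∑ k ∈ Finset.range (n + 1), aeval z (P s k) * aeval w (Q s k) := by
  rw [(isRec_P hp z).sum (isRec_Q hp w)]
  simp only [casorati, aeval_P_zero hs0, aeval_Q_zero, zero_add]
  linear_combination -jacobiB_mul_aeval_Q_one hp w

theorem casorati_Q_P (hp : PosDef s) (hs0 : s 0 = 1) (z w : K) (n : ℕ) :
    casorati s n (fun k => aeval z (Q s k)) (fun k => aeval w (P s k)) =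
      1 + (z - w) * ∑ k ∈ Finset.range (n + 1), aeval z (Q s k) * aeval w (P s k) := by
  rw [(isRec_Q hp z).sum (isRec_P hp w)]
  simp only [casorati, aeval_P_zero hs0, aeval_Q_zero, zero_add]
  linear_combination jacobiB_mul_aeval_Q_one hp z

theorem casorati_Q_Q (hp : PosDef s) (z w : K) (n : ℕ) :
    casorati s n (fun k => aeval z (Q s k)) (fun k => aeval w (Q s k)) =
      (z - w) * ∑ k ∈ Finset.range (n + 1), aeval z (Q s k) * aeval w (Q s k) := by
  rw [(isRec_Q hp z).sum (isRec_Q hp w)]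
  simp only [casorati, aeval_Q_zero]
  ring

theorem casorati_self (hp : PosDef s) (hs0 : s 0 = 1) (z : K) (n : ℕ) :
    algebraMap ℝ K (jacobiB s n) * (aeval z (Q s (n + 1)) * aeval z (P s n) -
      aeval z (Q s n) * aeval z (P s (n + 1))) = 1 := by
  have := casorati_Q_P hp hs0 z z n
  simpa [casorati] using this

/-- Every sequence is recovered from its Casorati determinants with `P` and `Q`. -/
theorem variation_of_constants (hp : PosDef s) (hs0 : s 0 = 1) (w : K) (f : ℕ → K) (n : ℕ) :
    f (n + 1) = casorati s n f (fun k => aeval w (P s k)) * aeval w (Q s (n + 1)) -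
      casorati s n f (fun k => aeval w (Q s k)) * aeval w (P s (n + 1)) := by
  simp only [casorati]
  linear_combination -f (n + 1) * casorati_self hp hs0 w n

/-- A Plücker identity: the left side is the product of the Casorati determinants of `Q`, `P` at `z`
and at `w`, both equal to `1`. In the limit it becomes `AD - BC = 1`. -/
theorem nevanlinna_det (hp : PosDef s) (hs0 : s 0 = 1) (z w : K) (n : ℕ) :
    casorati s n (fun k => aeval z (Q s k)) (fun k => aeval w (Q s k)) *
      casorati s n (fun k => aeval z (P s k)) (fun k => aeval w (P s k)) -
    casorati s n (fun k => aeval z (P s k)) (fun k => aeval w (Q s k)) *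
      casorati s n (fun k => aeval z (Q s k)) (fun k => aeval w (P s k)) = 1 := by
  have h1 := casorati_self hp hs0 z n
  have h2 := casorati_self hp hs0 w n
  simp only [casorati]
  linear_combination h1 + algebraMap ℝ K (jacobiB s n) * (aeval z (Q s (n + 1)) * aeval z (P s n) -
      aeval z (Q s n) * aeval z (P s (n + 1))) * h2

/-- The solutions of the inhomogeneous recurrence are `Q + h₀ P`. -/
theorem eq_Q_add_mul_P (hp : PosDef s) (hs0 : s 0 = 1) (z : K) (h : ℕ → K) (N : ℕ)
    (h1 : 0 < N → z * h 0 + 1 =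
      algebraMap ℝ K (jacobiB s 0) * h 1 + algebraMap ℝ K (jacobiA s 0) * h 0)
    (h2 : ∀ n, n + 1 < N → z * h (n + 1) = algebraMap ℝ K (jacobiB s (n + 1)) * h (n + 2) +
      algebraMap ℝ K (jacobiA s (n + 1)) * h (n + 1) + algebraMap ℝ K (jacobiB s n) * h n)
    {n : ℕ} (hn : n ≤ N) : h n = aeval z (Q s n) + h 0 * aeval z (P s n) := by
  induction n using Nat.strong_induction_on with
  | _ n ih =>
    match n with
    | 0 => simp [aeval_P_zero hs0, aeval_Q_zero]
    | 1 =>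
      apply mul_left_cancel₀ (algebraMap_jacobiB_ne_zero (K := K) hp 0)
      linear_combination -h1 hn - jacobiB_mul_aeval_Q_one hp z -
        h 0 * jacobiB_mul_aeval_P_one hp hs0 z
    | n + 2 =>
      apply mul_left_cancel₀ (algebraMap_jacobiB_ne_zero (K := K) hp (n + 1))
      have e0 := ih n (by omega) (by omega)
      have e1 := ih (n + 1) (by omega) (by omega)
      have hP := isRec_P hp z n
      have hQ := isRec_Q hp z n
      simp only at hP hQ
      linear_combination -h2 n hn + hQ + h 0 * hP +
        (z - algebraMap ℝ K (jacobiA s (n + 1))) * e1 - algebraMap ℝ K (jacobiB s n) * e0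

end Recurrence

/-! ### Growth of the solutions -/

/-- The bracket, not `g`, is estimated inductively: each step multiplies it by at most `1 + R v_n² ≤
exp (R v_n²)`. -/
theorem discrete_gronwall {v g : ℕ → ℝ} {R : ℝ} (hv : ∀ n, 0 ≤ v n) (hR : 0 ≤ R)
    (h : ∀ n, g n ≤ v n * (1 + R * ∑ k ∈ Finset.range n, v k * g k)) (n : ℕ) :
    g n ≤ v n * Real.exp (R * ∑ k ∈ Finset.range n, v k ^ 2) := by
  have key : ∀ n, 1 + R * ∑ k ∈ Finset.range n, v k * g k ≤
      Real.exp (R * ∑ k ∈ Finset.range n, v k ^ 2) := by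
    intro n
    induction n with
    | zero => simp
    | succ n ih =>
      rw [Finset.sum_range_succ, Finset.sum_range_succ, mul_add R _ (v n ^ 2), Real.exp_add]
      have e1 : 1 + R * (∑ k ∈ Finset.range n, v k * g k + v n * g n) ≤
          (1 + R * ∑ k ∈ Finset.range n, v k * g k) * (R * v n ^ 2 + 1) := by
        have := mul_le_mul_of_nonneg_left (h n) (mul_nonneg hR (hv n))
        nlinarith
      refine e1.trans (mul_le_mul ih (Real.add_one_le_exp _) ?_ (Real.exp_pos _).le)
      have := mul_nonneg hR (sq_nonneg (v n))
      linarith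
  exact (h n).trans (mul_le_mul_of_nonneg_left (key n) (hv n))

variable {s : ℕ → ℝ}

/-- Variation of constants with base point `w` writes `f (n + 1)` through `f 0, …, f n` with a
kernel bounded by `v_k v_{n+1}`, where `v = |P(w)| + |Q(w)|`; then Gronwall applies. The constants
`c`, `d` allow one proof for `f = P(z)` (`0`, `-1`) and `f = Q(z)` (`1`, `0`). -/
theorem norm_le_of_casorati (hp : PosDef s) (hs0 : s 0 = 1) {w z : ℂ} {f : ℕ → ℂ} {c d : ℂ}
    (hc : ‖c‖ ≤ 1) (hd : ‖d‖ ≤ 1) (h0 : ‖f 0‖ ≤ 1)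
    (h1 : ∀ n, casorati s n f (fun k => aeval w (P s k)) =
      c + (z - w) * ∑ k ∈ Finset.range (n + 1), f k * aeval w (P s k))
    (h2 : ∀ n, casorati s n f (fun k => aeval w (Q s k)) =
      d + (z - w) * ∑ k ∈ Finset.range (n + 1), f k * aeval w (Q s k)) (n : ℕ) :
    ‖f n‖ ≤ (‖aeval w (P s n)‖ + ‖aeval w (Q s n)‖) *
      Real.exp (‖z - w‖ * ∑ k ∈ Finset.range n,
        (‖aeval w (P s k)‖ + ‖aeval w (Q s k)‖) ^ 2) := by
  refine discrete_gronwall (v := fun n => ‖aeval w (P s n)‖ + ‖aeval w (Q s n)‖)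
    (g := fun n => ‖f n‖) (fun _ => by positivity) (norm_nonneg _) (fun n => ?_) n
  cases n with
  | zero =>
    simp only [aeval_P_zero hs0, aeval_Q_zero]
    simpa using h0
  | succ n =>
    rw [variation_of_constants hp hs0 w f n, h1, h2]
    have e : ∀ k, f k * aeval w (P s k) * aeval w (Q s (n + 1)) -
        f k * aeval w (Q s k) * aeval w (P s (n + 1)) =
        f k * (aeval w (P s k) * aeval w (Q s (n + 1)) -
          aeval w (Q s k) * aeval w (P s (n + 1))) := fun k => by ring
    have bnd : ∀ k, ‖f k * (aeval w (P s k) * aeval w (Q s (n + 1)) -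
        aeval w (Q s k) * aeval w (P s (n + 1)))‖ ≤
        (‖aeval w (P s (n + 1))‖ + ‖aeval w (Q s (n + 1))‖) *
          ((‖aeval w (P s k)‖ + ‖aeval w (Q s k)‖) * ‖f k‖) := by
      intro k
      rw [norm_mul]
      have h3 := norm_sub_le (aeval w (P s k) * aeval w (Q s (n + 1)))
        (aeval w (Q s k) * aeval w (P s (n + 1)))
      rw [norm_mul, norm_mul] at h3
      have h4 : 0 ≤ ‖aeval w (P s k)‖ * ‖aeval w (P s (n + 1))‖ +
        ‖aeval w (Q s k)‖ * ‖aeval w (Q s (n + 1))‖ := by positivity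
      have := mul_le_mul_of_nonneg_left (h3.trans (le_add_of_nonneg_right h4)) (norm_nonneg (f k))
      linarith
    calc _ = ‖(c * aeval w (Q s (n + 1)) - d * aeval w (P s (n + 1))) + (z - w) *
          ∑ k ∈ Finset.range (n + 1), f k * (aeval w (P s k) * aeval w (Q s (n + 1)) -
          aeval w (Q s k) * aeval w (P s (n + 1)))‖ := by
          congr 1
          simp only [← e, Finset.sum_sub_distrib, ← Finset.sum_mul]
          ring
      _ ≤ (‖aeval w (P s (n + 1))‖ + ‖aeval w (Q s (n + 1))‖) + ‖z - w‖ *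
          ∑ k ∈ Finset.range (n + 1), (‖aeval w (P s (n + 1))‖ + ‖aeval w (Q s (n + 1))‖) *
          ((‖aeval w (P s k)‖ + ‖aeval w (Q s k)‖) * ‖f k‖) := by
          refine (norm_add_le _ _).trans (add_le_add ?_ ?_)
          · refine (norm_sub_le _ _).trans ?_
            rw [norm_mul, norm_mul, add_comm]
            exact add_le_add (mul_le_of_le_one_left (norm_nonneg _) hd)
              (mul_le_of_le_one_left (norm_nonneg _) hc)
          · rw [norm_mul]
            exact mul_le_mul_of_nonneg_left (norm_sum_le_of_le _ fun k _ => bnd k) (norm_nonneg _)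
      _ = _ := by
          rw [← Finset.mul_sum]; ring

/-- The orthonormal polynomials and those of the second kind are dominated, locally uniformly in
`z`, by one square summable sequence. -/
def Dominated (s : ℕ → ℝ) (v : ℕ → ℝ) : Prop :=
  (∀ n, 0 ≤ v n) ∧ (Summable fun n => v n ^ 2) ∧ ∀ R : ℝ, ∃ M : ℝ, 0 ≤ M ∧
    ∀ z : ℂ, ‖z‖ ≤ R → ∀ n, ‖aeval z (P s n)‖ ≤ M * v n ∧ ‖aeval z (Q s n)‖ ≤ M * v n

theorem exists_dominated (hp : PosDef s) (hs0 : s 0 = 1) {w : ℂ}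
    (h1 : Summable fun k => ‖aeval w (P s k)‖ ^ 2)
    (h2 : Summable fun k => ‖aeval w (Q s k)‖ ^ 2) : ∃ v, Dominated s v := by
  set v : ℕ → ℝ := fun n => ‖aeval w (P s n)‖ + ‖aeval w (Q s n)‖ with hv
  have hv0 : ∀ n, 0 ≤ v n := fun n => by positivity
  have hsum : Summable fun n => v n ^ 2 := by
    refine Summable.of_nonneg_of_le (fun n => sq_nonneg _) (fun n => ?_)
      ((h1.add h2).mul_left 2)
    simp only [hv]
    nlinarith [sq_nonneg (‖aeval w (P s n)‖ - ‖aeval w (Q s n)‖)]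
  refine ⟨v, hv0, hsum, fun R => ⟨Real.exp ((|R| + ‖w‖) * ∑' n, v n ^ 2), (Real.exp_pos _).le,
    fun z hz n => ?_⟩⟩
  have hexp : Real.exp (‖z - w‖ * ∑ k ∈ Finset.range n, v k ^ 2) ≤
      Real.exp ((|R| + ‖w‖) * ∑' n, v n ^ 2) := by
    rw [Real.exp_le_exp]
    refine mul_le_mul ?_ (hsum.sum_le_tsum _ fun _ _ => sq_nonneg _)
      (Finset.sum_nonneg fun _ _ => sq_nonneg _) (by positivity)
    exact (norm_sub_le _ _).trans (add_le_add_left (hz.trans (le_abs_self R)) _)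
  have aux : ∀ f : ℕ → ℂ, ‖f n‖ ≤ v n * Real.exp (‖z - w‖ * ∑ k ∈ Finset.range n, v k ^ 2) →
      ‖f n‖ ≤ Real.exp ((|R| + ‖w‖) * ∑' n, v n ^ 2) * v n := fun f hf => by
    rw [mul_comm]
    exact hf.trans (mul_le_mul_of_nonneg_left hexp (hv0 n))
  constructor
  · refine aux (fun n => aeval z (P s n)) (norm_le_of_casorati hp hs0 (f := fun n => aeval z (P s n))
      (c := 0) (d := -1)
      (by simp) (by simp) (by simp [aeval_P_zero hs0]) (fun n => ?_) (fun n => ?_) n)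
    · rw [casorati_P_P hp hs0, zero_add]
    · rw [casorati_P_Q hp hs0]
  · refine aux (fun n => aeval z (Q s n)) (norm_le_of_casorati hp hs0 (f := fun n => aeval z (Q s n))
      (c := 1) (d := 0)
      (by simp) (by simp) (by simp [aeval_Q_zero]) (fun n => ?_) (fun n => ?_) n)
    · rw [casorati_Q_P hp hs0]
    · rw [casorati_Q_Q hp, zero_add]

end StieltjesMoment

namespace StieltjesMoment

/-! ### Powers of the resolvent -/

/-- `z` has positive distance to `μ`-almost every point. -/
def Away (μ : Measure ℝ) (z : ℂ) : Prop := ∃ δ > 0, ∀ᵐ t : ℝ ∂μ, δ ≤ ‖(t : ℂ) - z‖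

theorem away_of_im_ne_zero (μ : Measure ℝ) {z : ℂ} (hz : z.im ≠ 0) : Away μ z := by
  refine ⟨|z.im|, abs_pos.2 hz, Eventually.of_forall fun t => ?_⟩
  have := Complex.abs_im_le_norm ((t : ℂ) - z)
  simpa using this

theorem away_of_re_neg {μ : Measure ℝ} (hμ : μ (Set.Iio 0) = 0) {z : ℂ} (hz : z.re < 0) :
    Away μ z := by
  refine ⟨-z.re, by linarith, ?_⟩
  have h0 : ∀ᵐ t : ℝ ∂μ, t ∉ Set.Iio (0 : ℝ) := measure_eq_zero_iff_ae_notMem.1 hμ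
  filter_upwards [h0] with t ht
  have h1 := Complex.abs_re_le_norm ((t : ℂ) - z)
  have h2 : 0 ≤ t := by simpa using ht
  simp only [Complex.sub_re, Complex.ofReal_re] at h1
  exact le_trans (by linarith) ((le_abs_self _).trans h1)

theorem measurable_resolvent_pow (z : ℂ) (m : ℕ) :
    Measurable fun t : ℝ => (((t : ℂ) - z)⁻¹) ^ m := by fun_prop

theorem Away.norm_resolvent_le {μ : Measure ℝ} {z : ℂ} (h : Away μ z) :
    ∃ M, 0 ≤ M ∧ ∀ᵐ t : ℝ ∂μ, ‖((t : ℂ) - z)⁻¹‖ ≤ M := by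
  obtain ⟨δ, hδ, h⟩ := h
  refine ⟨δ⁻¹, (inv_pos.2 hδ).le, ?_⟩
  filter_upwards [h] with t ht
  rw [norm_inv]
  exact inv_anti₀ hδ ht

theorem integrable_resolvent_pow {μ : Measure ℝ} [IsFiniteMeasure μ] {z : ℂ} (h : Away μ z)
    (m : ℕ) : Integrable (fun t : ℝ => (((t : ℂ) - z)⁻¹) ^ m) μ := by
  obtain ⟨M, _, h⟩ := h.norm_resolvent_le
  refine Integrable.of_bound (measurable_resolvent_pow z m).aestronglyMeasurable (M ^ m) ?_
  filter_upwards [h] with t ht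
  rw [norm_pow]
  exact pow_le_pow_left₀ (norm_nonneg _) ht m

theorem hasDerivAt_integral_resolvent_pow {μ : Measure ℝ} [IsFiniteMeasure μ] {z : ℂ}
    (h : Away μ z) (m : ℕ) :
    HasDerivAt (fun z => ∫ t : ℝ, (((t : ℂ) - z)⁻¹) ^ m ∂μ)
      (∫ t : ℝ, m * (((t : ℂ) - z)⁻¹) ^ (m + 1) ∂μ) z := by
  obtain ⟨δ, hδ, h'⟩ := id h
  refine (hasDerivAt_integral_of_dominated_loc_of_deriv_le (s := Metric.ball z (δ / 2))
    (bound := fun _ => m * ((δ / 2)⁻¹) ^ (m + 1))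
    (F' := fun z t => m * (((t : ℂ) - z)⁻¹) ^ (m + 1))
    (Metric.ball_mem_nhds z (half_pos hδ))
    (Eventually.of_forall fun w => (measurable_resolvent_pow w m).aestronglyMeasurable)
    (integrable_resolvent_pow h m)
    ((measurable_resolvent_pow z (m + 1)).const_mul _).aestronglyMeasurable ?_
    (integrable_const _) ?_).2
  all_goals
    filter_upwards [h'] with t ht w hw
    have hw' : ‖w - z‖ < δ / 2 := by simpa [dist_eq_norm] using hw
    have hd : δ / 2 ≤ ‖(t : ℂ) - w‖ := by
      have := norm_sub_norm_le ((t : ℂ) - z) (w - z)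
      rw [sub_sub_sub_cancel_right] at this
      linarith
  · rw [norm_mul, norm_pow, norm_inv, Complex.norm_natCast]
    gcongr
  · have hne : (t : ℂ) - w ≠ 0 := norm_pos_iff.1 ((half_pos hδ).trans_le hd)
    have h1 : HasDerivAt (fun z : ℂ => ((t : ℂ) - z)⁻¹) (((t : ℂ) - w)⁻¹ ^ 2) w := by
      refine (((hasDerivAt_id w).const_sub (t : ℂ)).inv hne).congr_deriv ?_
      simp
    refine (h1.pow m).congr_deriv ?_
    rcases m with _ | m
    · simp
    · rw [Nat.add_sub_cancel]; ring

/-- Differentiation under the integral raises the power of the resolvent by one, and equality on an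
open set survives differentiation. -/
theorem integral_resolvent_pow_eqOn {μ ν : Measure ℝ} [IsFiniteMeasure μ] [IsFiniteMeasure ν]
    {U : Set ℂ} (hU : IsOpen U) (hμ : ∀ z ∈ U, Away μ z) (hν : ∀ z ∈ U, Away ν z)
    (h : ∀ z ∈ U, ∫ t : ℝ, ((t : ℂ) - z)⁻¹ ∂μ = ∫ t : ℝ, ((t : ℂ) - z)⁻¹ ∂ν) (m : ℕ) :
    ∀ z ∈ U, ∫ t : ℝ, (((t : ℂ) - z)⁻¹) ^ (m + 1) ∂μ =
      ∫ t : ℝ, (((t : ℂ) - z)⁻¹) ^ (m + 1) ∂ν := by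
  induction m with
  | zero => simpa using h
  | succ m ih =>
    intro z hz
    have h1 := hasDerivAt_integral_resolvent_pow (hμ z hz) (m + 1)
    have h2 := hasDerivAt_integral_resolvent_pow (hν z hz) (m + 1)
    have h3 := h1.congr_of_eventuallyEq (f₁ := fun z => ∫ t : ℝ, (((t : ℂ) - z)⁻¹) ^ (m + 1) ∂ν)
      (by filter_upwards [hU.mem_nhds hz] with w hw using (ih w hw).symm)
    have h4 := h3.unique h2
    rw [integral_const_mul, integral_const_mul] at h4
    exact mul_left_cancel₀ (by exact_mod_cast Nat.succ_ne_zero m) h4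

/-- The bounded continuous function `t ↦ (t - i)⁻¹`. -/
noncomputable def resolventI : BoundedContinuousFunction ℝ ℂ :=
  BoundedContinuousFunction.ofNormedAddCommGroup (fun t : ℝ => ((t : ℂ) - Complex.I)⁻¹)
    (by
      refine Continuous.inv₀ (by fun_prop) fun t h => ?_
      simpa using congrArg Complex.im h) 1
    (by
      intro t
      rw [norm_inv]
      refine inv_le_one_of_one_le₀ ?_
      have := Complex.abs_im_le_norm ((t : ℂ) - Complex.I)
      simpa using this)

theorem star_resolventI_apply (t : ℝ) : star resolventI t = ((t : ℂ) - (-Complex.I))⁻¹ := by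
  change (starRingEnd ℂ) (((t : ℂ) - Complex.I)⁻¹) = _
  simp

/-- A finite measure is determined by its mass and its Stieltjes transform off the real axis. -/
theorem measure_ext_of_stieltjes {μ ν : Measure ℝ} [IsFiniteMeasure μ] [IsFiniteMeasure ν]
    (h0 : μ.real Set.univ = ν.real Set.univ)
    (h : ∀ z : ℂ, z.im ≠ 0 → ∫ t : ℝ, ((t : ℂ) - z)⁻¹ ∂μ = ∫ t : ℝ, ((t : ℂ) - z)⁻¹ ∂ν) :
    μ = ν := by
  have hU : IsOpen {z : ℂ | z.im ≠ 0} := isOpen_ne_fun Complex.continuous_im continuous_const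
  have hpow : ∀ z : ℂ, z.im ≠ 0 → ∀ m, ∫ t : ℝ, (((t : ℂ) - z)⁻¹) ^ m ∂μ =
      ∫ t : ℝ, (((t : ℂ) - z)⁻¹) ^ m ∂ν := by
    intro z hz m
    rcases m with _ | m
    · simp [h0]
    · exact integral_resolvent_pow_eqOn hU (fun z hz => away_of_im_ne_zero μ hz)
        (fun z hz => away_of_im_ne_zero ν hz) h m z hz
  have hI : Complex.I.im ≠ 0 := by simp
  have hI' : (-Complex.I).im ≠ 0 := by simp
  -- Partial fractions, `1/((t - i)(t + i)) = (2i)⁻¹ (1/(t - i) - 1/(t + i))`, lower one exponent at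
  -- a time until only pure powers remain.
  have key : ∀ a b : ℕ, ∫ t : ℝ, (resolventI ^ a * star resolventI ^ b) t ∂μ =
      ∫ t : ℝ, (resolventI ^ a * star resolventI ^ b) t ∂ν := by
    intro a
    induction a with
    | zero =>
      intro b
      have := hpow _ hI' b
      simp only [← star_resolventI_apply] at this
      simpa only [pow_zero, one_mul, BoundedContinuousFunction.pow_apply] using this
    | succ a iha =>
      intro b
      induction b with
      | zero =>
        simp only [pow_zero, mul_one, BoundedContinuousFunction.pow_apply]
        exact hpow _ hI (a + 1)
      | succ b ihb =>
        have e : ∀ t : ℝ, (resolventI ^ (a + 1) * star resolventI ^ (b + 1)) t =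
            (2 * Complex.I)⁻¹ * ((resolventI ^ (a + 1) * star resolventI ^ b) t -
              (resolventI ^ a * star resolventI ^ (b + 1)) t) := by
          intro t
          have h1 : resolventI t * star resolventI t =
              (2 * Complex.I)⁻¹ * (resolventI t - star resolventI t) := by
            have e1 : (t : ℂ) - Complex.I ≠ 0 := fun h => by simpa using congrArg Complex.im h
            have e2 : (t : ℂ) - -Complex.I ≠ 0 := fun h => by simpa using congrArg Complex.im h
            rw [star_resolventI_apply]
            change ((t : ℂ) - Complex.I)⁻¹ * _ = _ * (((t : ℂ) - Complex.I)⁻¹ - _)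
            field_simp
            ring
          simp only [BoundedContinuousFunction.mul_apply, BoundedContinuousFunction.pow_apply]
          linear_combination (resolventI t) ^ a * (star resolventI t) ^ b * h1
        simp only [e]
        rw [integral_const_mul, integral_const_mul, integral_sub, integral_sub, ihb, iha]
        all_goals exact BoundedContinuousFunction.integrable _ _
  -- The star algebra generated by `(t - i)⁻¹` separates points, and it is spanned by the monomials
  -- treated in `key`.
  refine ext_of_forall_mem_subalgebra_integral_eq_of_pseudoEMetric_complete_countable (𝕜 := ℂ)
    (A := StarAlgebra.adjoin ℂ {resolventI}) ?_ ?_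
  · intro x y hxy
    refine ⟨resolventI, ⟨resolventI.toContinuousMap, ?_, rfl⟩, ?_⟩
    · exact ⟨resolventI, StarAlgebra.self_mem_adjoin_singleton ℂ resolventI, rfl⟩
    · intro h
      change ((x : ℂ) - Complex.I)⁻¹ = ((y : ℂ) - Complex.I)⁻¹ at h
      apply hxy
      simpa using h
  · intro g hg
    have hg' : g ∈ Submodule.span ℂ
        (Submonoid.closure ({resolventI, star resolventI} : Set (BoundedContinuousFunction ℝ ℂ)) :
          Set (BoundedContinuousFunction ℝ ℂ)) := by
      rw [← Algebra.adjoin_eq_span]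
      have : g ∈ (StarAlgebra.adjoin ℂ {resolventI}).toSubalgebra := hg
      rw [StarAlgebra.adjoin_toSubalgebra, Set.star_singleton] at this
      exact this
    clear hg
    induction hg' using Submodule.span_induction with
    | mem f hf =>
      obtain ⟨a, b, rfl⟩ := (Submonoid.mem_closure_pair _ _ _).1 hf
      exact key a b
    | zero => simp
    | add f g _ _ hf hg =>
      simp only [BoundedContinuousFunction.add_apply]
      rw [integral_add, integral_add, hf, hg]
      all_goals exact BoundedContinuousFunction.integrable _ _
    | smul c f _ hf =>
      simp only [BoundedContinuousFunction.smul_apply, integral_smul, hf]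

/-- For measures on the half-line, the Stieltjes transform on the negative axis suffices. -/
theorem measure_ext_of_stieltjes_neg {μ ν : Measure ℝ} [IsFiniteMeasure μ] [IsFiniteMeasure ν]
    (h0 : μ.real Set.univ = ν.real Set.univ) (hμ : μ (Set.Iio 0) = 0) (hν : ν (Set.Iio 0) = 0)
    (h : ∀ x : ℝ, x < 0 → ∫ t : ℝ, (t - x)⁻¹ ∂μ = ∫ t : ℝ, (t - x)⁻¹ ∂ν) : μ = ν := by
  refine measure_ext_of_stieltjes h0 ?_
  -- `U` is the plane cut along `[0, ∞)`. Both transforms are analytic there and agree on the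
  -- negative axis, so the identity theorem at `-1` makes them agree on all of `U`.
  set U : Set ℂ := {z | -z ∈ Complex.slitPlane} with hU
  have hUo : IsOpen U := Complex.isOpen_slitPlane.preimage continuous_neg
  have hUc : IsPreconnected U := by
    have : U = (fun z => -z) '' Complex.slitPlane := by
      ext z; simp [hU]
    rw [this]
    refine IsPreconnected.image ?_ _ continuous_neg.continuousOn
    exact (Complex.starConvex_one_slitPlane.isPathConnected
      Complex.one_mem_slitPlane).isConnected.isPreconnected
  have away : ∀ (κ : Measure ℝ), κ (Set.Iio 0) = 0 → ∀ z ∈ U, Away κ z := by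
    intro κ hκ z hz
    rcases Complex.mem_slitPlane_iff.1 hz with h | h
    · exact away_of_re_neg hκ (by simpa using h)
    · exact away_of_im_ne_zero κ (by simpa using h)
  have diff : ∀ (κ : Measure ℝ) [IsFiniteMeasure κ], κ (Set.Iio 0) = 0 →
      AnalyticOnNhd ℂ (fun z => ∫ t : ℝ, ((t : ℂ) - z)⁻¹ ∂κ) U := by
    intro κ _ hκ
    refine DifferentiableOn.analyticOnNhd (fun z hz => ?_) hUo
    have := (hasDerivAt_integral_resolvent_pow (away κ hκ z hz) 1).differentiableAt
    simp only [pow_one] at this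
    exact this.differentiableWithinAt
  have hm1 : (-1 : ℂ) ∈ U := by simp [hU]
  have heq : Set.EqOn (fun z => ∫ t : ℝ, ((t : ℂ) - z)⁻¹ ∂μ)
      (fun z => ∫ t : ℝ, ((t : ℂ) - z)⁻¹ ∂ν) U := by
    refine (diff μ hμ).eqOn_of_preconnected_of_frequently_eq (diff ν hν) hUc hm1 ?_
    have ht : Tendsto (fun x : ℝ => (x : ℂ)) (𝓝[≠] (-1)) (𝓝[≠] (-1)) := by
      refine tendsto_nhdsWithin_of_tendsto_nhds_of_eventually_within _ ?_ ?_
      · have := (Complex.continuous_ofReal.tendsto (-1 : ℝ)).mono_left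
          (nhdsWithin_le_nhds (s := {(-1 : ℝ)}ᶜ))
        simpa using this
      · filter_upwards [self_mem_nhdsWithin] with x hx
        simp only [Set.mem_compl_iff, Set.mem_singleton_iff] at hx ⊢
        exact_mod_cast hx
    refine ht.frequently (Eventually.frequently ?_)
    have : ∀ᶠ x : ℝ in 𝓝[≠] (-1), x < 0 :=
      (eventually_lt_nhds (by norm_num)).filter_mono nhdsWithin_le_nhds
    filter_upwards [this] with x hx
    have := congrArg (fun r : ℝ => (r : ℂ)) (h x hx)
    simp only [← integral_complex_ofReal] at this
    simpa using this
  intro z hz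
  exact heq (by simp [hU, Complex.mem_slitPlane_iff, hz])

end StieltjesMoment

namespace StieltjesMoment

/-! ### Solutions of the moment problem -/

variable {s : ℕ → ℝ} {μ : Measure ℝ}

theorem IsSolution.isFiniteMeasure (h : IsSolution s μ) : IsFiniteMeasure μ := by
  have := (h 0).1
  simp only [pow_zero] at this
  exact (integrable_const_iff_isFiniteMeasure one_ne_zero).1 this

theorem IsSolution.integrable_eval (h : IsSolution s μ) (p : ℝ[X]) :
    Integrable (fun t => p.eval t) μ := by
  simp only [eval_eq_sum, Polynomial.sum]
  exact integrable_finsetSum _ fun n _ => (h n).1.const_mul _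

theorem IsSolution.integral_eval (h : IsSolution s μ) (p : ℝ[X]) :
    ∫ t, p.eval t ∂μ = momentFun s p := by
  simp only [eval_eq_sum, Polynomial.sum, momentFun]
  rw [integral_finsetSum _ fun n _ => (h n).1.const_mul _]
  simp only [integral_const_mul, (h _).2]

theorem IsSolution.real_univ (h : IsSolution s μ) : μ.real Set.univ = s 0 := by
  simpa using (h 0).2

theorem ae_nonneg_of_measure_Iio (hμ : μ (Set.Iio 0) = 0) : ∀ᵐ t : ℝ ∂μ, 0 ≤ t := by
  filter_upwards [measure_eq_zero_iff_ae_notMem.1 hμ] with t ht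
  simpa using ht

/-- On a finite set every function is a polynomial, by Lagrange interpolation, so its integral is
determined by the moments. -/
theorem eq_of_ae_mem_finset {μ ν : Measure ℝ} (hμ : IsSolution s μ) (hν : IsSolution s ν)
    (S : Finset ℝ) (h1 : ∀ᵐ t ∂μ, t ∈ S) (h2 : ∀ᵐ t ∂ν, t ∈ S) : μ = ν := by
  have := hμ.isFiniteMeasure
  have := hν.isFiniteMeasure
  refine ext_of_forall_integral_eq_of_IsFiniteMeasure fun f => ?_
  have key : ∀ κ : Measure ℝ, IsSolution s κ → (∀ᵐ t ∂κ, t ∈ S) →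
      ∫ t, f t ∂κ = momentFun s (Lagrange.interpolate S id f) := by
    intro κ hκ h
    rw [← hκ.integral_eval]
    refine integral_congr_ae ?_
    filter_upwards [h] with t ht
    exact (Lagrange.eval_interpolate_at_node f (Set.injOn_id _) ht).symm
  rw [key μ hμ h1, key ν hν h2]

/-- If the value were `0`, both half-line solutions would live on the finite zero set of `p` and
therefore coincide. -/
theorem IndetS.momentFun_pos (hs : IndetS s) {p : ℝ[X]} (hp : ∀ t, 0 ≤ t → 0 ≤ p.eval t)
    (hp0 : p ≠ 0) : 0 < momentFun s p := by
  obtain ⟨μ₁, μ₂, h1, h2, hn1, hn2, hne⟩ := hs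
  have nonneg : ∀ κ : Measure ℝ, κ (Set.Iio 0) = 0 → ∀ᵐ t ∂κ, 0 ≤ p.eval t := fun κ hκ => by
    filter_upwards [ae_nonneg_of_measure_Iio hκ] with t ht using hp t ht
  have h0 : 0 ≤ momentFun s p := by
    rw [← h1.integral_eval]
    exact integral_nonneg_of_ae (nonneg _ hn1)
  refine h0.lt_of_ne fun h => hne ?_
  have ae : ∀ κ : Measure ℝ, IsSolution s κ → κ (Set.Iio 0) = 0 →
      ∀ᵐ t ∂κ, t ∈ p.roots.toFinset := by
    intro κ hκ hκ0
    have := (integral_eq_zero_iff_of_nonneg_ae (nonneg κ hκ0) (hκ.integrable_eval p)).1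
      (by rw [hκ.integral_eval, ← h])
    filter_upwards [this] with t ht
    rw [Multiset.mem_toFinset, mem_roots hp0]
    exact ht
  exact eq_of_ae_mem_finset h1 h2 _ (ae _ h1 hn1) (ae _ h2 hn2)

theorem IndetS.posDef (hs : IndetS s) : PosDef s := fun p hp =>
  hs.momentFun_pos (fun t _ => by rw [eval_mul]; exact mul_self_nonneg _) (mul_self_ne_zero.2 hp)

/-- Bessel's inequality. -/
theorem bessel (hp : PosDef s) (h : IsSolution s μ) {f : ℝ → ℝ}
    (hf : ∀ p : ℝ[X], Integrable (fun t => p.eval t * f t) μ)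
    (hf2 : Integrable (fun t => f t ^ 2) μ) (n : ℕ) :
    ∑ k ∈ Finset.range n, (∫ t, (P s k).eval t * f t ∂μ) ^ 2 ≤ ∫ t, f t ^ 2 ∂μ := by
  set c : ℕ → ℝ := fun k => ∫ t, (P s k).eval t * f t ∂μ with hc
  set g : ℝ[X] := ∑ k ∈ Finset.range n, C (c k) * P s k with hg
  have h1 : ∫ t, g.eval t * f t ∂μ = ∑ k ∈ Finset.range n, c k ^ 2 := by
    simp only [hg, eval_finsetSum, Finset.sum_mul, eval_mul, eval_C, mul_assoc]
    rw [integral_finsetSum _ fun k _ => (hf (P s k)).const_mul _]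
    simp only [integral_const_mul, sq, hc]
  have h2 : ∫ t, (g * g).eval t ∂μ = ∑ k ∈ Finset.range n, c k ^ 2 := by
    rw [h.integral_eval]
    conv_lhs => rw [hg, Finset.sum_mul, momentFun_sum]
    refine Finset.sum_congr rfl fun k hk => ?_
    rw [mul_assoc, momentFun_C_mul, Finset.mul_sum, momentFun_sum, Finset.sum_eq_single k, sq]
    · rw [mul_left_comm, momentFun_C_mul, momentFun_P_mul_P hp, if_pos rfl, mul_one]
    · intro j _ hj
      rw [mul_left_comm, momentFun_C_mul, momentFun_P_mul_P hp, if_neg (Ne.symm hj), mul_zero]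
    · exact fun h' => absurd hk h'
  have h3 : 0 ≤ ∫ t, (f t - g.eval t) ^ 2 ∂μ := integral_nonneg fun t => sq_nonneg _
  have h4 : ∫ t, (f t - g.eval t) ^ 2 ∂μ =
      ∫ t, f t ^ 2 ∂μ - 2 * ∫ t, g.eval t * f t ∂μ + ∫ t, (g * g).eval t ∂μ := by
    have hsub : Integrable (fun t => f t ^ 2 - 2 * (g.eval t * f t)) μ :=
      hf2.sub ((hf g).const_mul 2)
    rw [← integral_const_mul, ← integral_sub hf2 ((hf g).const_mul 2),
      ← integral_add hsub (h.integrable_eval _)]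
    refine integral_congr_ae (Eventually.of_forall fun t => ?_)
    simp only [eval_mul]
    ring
  rw [h4, h1, h2] at h3
  linarith

theorem aeval_ofReal (x : ℝ) (p : ℝ[X]) : aeval (x : ℂ) p = ((p.eval x : ℝ) : ℂ) := by
  rw [← Complex.coe_algebraMap, aeval_algebraMap_apply, Polynomial.coe_aeval_eq_eval]

theorem IsSolution.integrable_mul_resolvent (h : IsSolution s μ) {z : ℂ} (hz : Away μ z)
    (p : ℝ[X]) : Integrable (fun t : ℝ => ((p.eval t : ℝ) : ℂ) * ((t : ℂ) - z)⁻¹) μ := by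
  obtain ⟨M, _, hM⟩ := hz.norm_resolvent_le
  refine ((h.integrable_eval p).ofReal (𝕜 := ℂ)).mul_bdd (c := M) ?_ hM
  have := measurable_resolvent_pow z 1
  simp only [pow_one] at this
  exact this.aestronglyMeasurable

/-- The functions of the second kind. -/
theorem IsSolution.integral_P_mul_resolvent (hp : PosDef s) (hs0 : s 0 = 1) (h : IsSolution s μ)
    {z : ℂ} (hz : Away μ z) (n : ℕ) :
    ∫ t : ℝ, (((P s n).eval t : ℝ) : ℂ) * ((t : ℂ) - z)⁻¹ ∂μ =
      aeval z (Q s n) + (∫ t : ℝ, ((t : ℂ) - z)⁻¹ ∂μ) * aeval z (P s n) := by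
  have hint := h.integrable_mul_resolvent hz
  obtain ⟨δ, hδ, hae⟩ := hz
  -- From `t/(t - z) = z/(t - z) + 1`. The extra term `momentFun s p` is `1` for `p = P 0` and `0`
  -- for later `P k`, which is exactly the inhomogeneity in `eq_Q_add_mul_P`.
  have hX : ∀ p : ℝ[X], ∫ t : ℝ, (((X * p).eval t : ℝ) : ℂ) * ((t : ℂ) - z)⁻¹ ∂μ =
      z * ∫ t : ℝ, ((p.eval t : ℝ) : ℂ) * ((t : ℂ) - z)⁻¹ ∂μ + (momentFun s p : ℂ) := by
    intro p
    have hre : Integrable (fun t => ((p.eval t : ℝ) : ℂ)) μ := (h.integrable_eval p).ofReal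
    rw [← h.integral_eval, ← integral_complex_ofReal, ← integral_const_mul, ← integral_add
      ((hint p).const_mul z) hre]
    refine integral_congr_ae ?_
    filter_upwards [hae] with t ht
    have hne : (t : ℂ) - z ≠ 0 := norm_pos_iff.1 (hδ.trans_le ht)
    simp only [eval_mul, eval_X, Complex.ofReal_mul]
    field_simp
    ring
  have hC : ∀ (c : ℝ) (p : ℝ[X]), ∫ t : ℝ, (((C c * p).eval t : ℝ) : ℂ) * ((t : ℂ) - z)⁻¹ ∂μ =
      c * ∫ t : ℝ, ((p.eval t : ℝ) : ℂ) * ((t : ℂ) - z)⁻¹ ∂μ := by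
    intro c p
    rw [← integral_const_mul]
    simp only [eval_mul, eval_C, Complex.ofReal_mul, mul_assoc]
  have hadd : ∀ p q : ℝ[X], ∫ t : ℝ, (((p + q).eval t : ℝ) : ℂ) * ((t : ℂ) - z)⁻¹ ∂μ =
      ∫ t : ℝ, ((p.eval t : ℝ) : ℂ) * ((t : ℂ) - z)⁻¹ ∂μ +
        ∫ t : ℝ, ((q.eval t : ℝ) : ℂ) * ((t : ℂ) - z)⁻¹ ∂μ := by
    intro p q
    rw [← integral_add (hint p) (hint q)]
    simp only [eval_add, Complex.ofReal_add, add_mul]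
  have hmom : ∀ k, momentFun s (P s k) = if k = 0 then 1 else 0 := by
    intro k
    rw [← momentFun_P_mul_P hp k 0, P_zero hs0, mul_one]
  have key := eq_Q_add_mul_P hp hs0 z
    (fun n => ∫ t : ℝ, (((P s n).eval t : ℝ) : ℂ) * ((t : ℂ) - z)⁻¹ ∂μ) n (fun _ => ?_)
    (fun k _ => ?_) le_rfl
  · rw [key, P_zero hs0]
    simp
  · have := hX (P s 0)
    rw [X_mul_P_zero hp, hadd, hC, hC, hmom] at this
    simpa using this.symm
  · have := hX (P s (k + 1))
    rw [X_mul_P_succ hp, hadd, hadd, hC, hC, hC, hmom] at this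
    simpa using this.symm

/-- `bessel` is stated for real functions, so it is applied to the real and imaginary parts of the
resolvent. -/
theorem IsSolution.summable_norm_sq (hp : PosDef s) (h : IsSolution s μ) {z : ℂ}
    (hz : Away μ z) :
    Summable fun n => ‖∫ t : ℝ, (((P s n).eval t : ℝ) : ℂ) * ((t : ℂ) - z)⁻¹ ∂μ‖ ^ 2 := by
  have := h.isFiniteMeasure
  have hint := h.integrable_mul_resolvent hz
  obtain ⟨M, hM0, hM⟩ := hz.norm_resolvent_le
  have meas : Measurable fun t : ℝ => ((t : ℂ) - z)⁻¹ := by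
    simpa using measurable_resolvent_pow z 1
  have hre : ∀ p : ℝ[X], Integrable (fun t => p.eval t * (((t : ℂ) - z)⁻¹).re) μ := fun p => by
    have := (hint p).re
    simpa only [RCLike.re_to_complex, Complex.re_ofReal_mul] using this
  have him : ∀ p : ℝ[X], Integrable (fun t => p.eval t * (((t : ℂ) - z)⁻¹).im) μ := fun p => by
    have := (hint p).im
    simpa only [RCLike.im_to_complex, Complex.im_ofReal_mul] using this
  have hre2 : Integrable (fun t : ℝ => (((t : ℂ) - z)⁻¹).re ^ 2) μ := by
    refine Integrable.of_bound (by fun_prop) (M ^ 2) ?_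
    filter_upwards [hM] with t ht
    rw [Real.norm_eq_abs, abs_pow]
    exact pow_le_pow_left₀ (abs_nonneg _) ((Complex.abs_re_le_norm _).trans ht) 2
  have him2 : Integrable (fun t : ℝ => (((t : ℂ) - z)⁻¹).im ^ 2) μ := by
    refine Integrable.of_bound (by fun_prop) (M ^ 2) ?_
    filter_upwards [hM] with t ht
    rw [Real.norm_eq_abs, abs_pow]
    exact pow_le_pow_left₀ (abs_nonneg _) ((Complex.abs_im_le_norm _).trans ht) 2
  refine summable_of_sum_range_le (c := ∫ t : ℝ, (((t : ℂ) - z)⁻¹).re ^ 2 ∂μ +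
    ∫ t : ℝ, (((t : ℂ) - z)⁻¹).im ^ 2 ∂μ) (fun n => by positivity) fun n => ?_
  refine le_trans (le_of_eq ?_) (add_le_add (bessel hp h hre hre2 n) (bessel hp h him him2 n))
  rw [← Finset.sum_add_distrib]
  refine Finset.sum_congr rfl fun k _ => ?_
  rw [Complex.sq_norm, Complex.normSq_apply, ← sq, ← sq]
  congr 2
  · have := integral_re (𝕜 := ℂ) (hint (P s k))
    simp only [RCLike.re_to_complex, Complex.re_ofReal_mul] at this
    exact this.symm
  · have := integral_im (𝕜 := ℂ) (hint (P s k))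
    simp only [RCLike.im_to_complex, Complex.im_ofReal_mul] at this
    exact this.symm

theorem summable_norm_sq_add {f g : ℕ → ℂ} (hf : Summable fun n => ‖f n‖ ^ 2)
    (hg : Summable fun n => ‖g n‖ ^ 2) (a b : ℂ) : Summable fun n => ‖a * f n + b * g n‖ ^ 2 := by
  refine Summable.of_nonneg_of_le (fun n => by positivity) (fun n => ?_)
    ((hf.mul_left (2 * ‖a‖ ^ 2)).add (hg.mul_left (2 * ‖b‖ ^ 2)))
  have h1 := norm_add_le (a * f n) (b * g n)
  rw [norm_mul, norm_mul] at h1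
  have h2 := pow_le_pow_left₀ (norm_nonneg _) h1 2
  nlinarith [sq_nonneg (‖a‖ * ‖f n‖ - ‖b‖ * ‖g n‖)]

/-- Two solutions give square summable sequences `Q + w₁ P` and `Q + w₂ P` at one point `z` with `w₁
≠ w₂`; solving this linear system isolates `P` and `Q`. -/
theorem IndetS.exists_dominated (hs : IndetS s) (hs0 : s 0 = 1) : ∃ v, Dominated s v := by
  have hp := hs.posDef
  obtain ⟨μ₁, μ₂, h1, h2, -, -, hne⟩ := hs
  have := h1.isFiniteMeasure
  have := h2.isFiniteMeasure
  obtain ⟨z, hz, hw⟩ : ∃ z : ℂ, z.im ≠ 0 ∧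
      ∫ t : ℝ, ((t : ℂ) - z)⁻¹ ∂μ₁ ≠ ∫ t : ℝ, ((t : ℂ) - z)⁻¹ ∂μ₂ := by
    by_contra! hcon
    exact hne (measure_ext_of_stieltjes (by rw [h1.real_univ, h2.real_univ]) hcon)
  have s1 := h1.summable_norm_sq hp (away_of_im_ne_zero μ₁ hz)
  have s2 := h2.summable_norm_sq hp (away_of_im_ne_zero μ₂ hz)
  simp only [h1.integral_P_mul_resolvent hp hs0 (away_of_im_ne_zero μ₁ hz),
    h2.integral_P_mul_resolvent hp hs0 (away_of_im_ne_zero μ₂ hz)] at s1 s2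
  set w₁ := ∫ t : ℝ, ((t : ℂ) - z)⁻¹ ∂μ₁
  set w₂ := ∫ t : ℝ, ((t : ℂ) - z)⁻¹ ∂μ₂
  have hw' : w₁ - w₂ ≠ 0 := sub_ne_zero.2 hw
  refine StieltjesMoment.exists_dominated hp hs0 (w := z) ?_ ?_
  · refine (summable_norm_sq_add s1 s2 (w₁ - w₂)⁻¹ (-(w₁ - w₂)⁻¹)).congr fun n => ?_
    congr 2
    field_simp
    ring
  · refine (summable_norm_sq_add s1 s2 (-w₂ * (w₁ - w₂)⁻¹) (w₁ * (w₁ - w₂)⁻¹)).congr fun n => ?_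
    congr 2
    field_simp
    ring

end StieltjesMoment

namespace StieltjesMoment

/-! ### Zeros of the orthonormal polynomials -/

variable {s : ℕ → ℝ}

/-- The reciprocal Christoffel function `∑_{k<n} P_k(x)²`. -/
noncomputable def christoffel (s : ℕ → ℝ) (n : ℕ) (x : ℝ) : ℝ :=
  ∑ k ∈ Finset.range n, (P s k).eval x ^ 2

theorem one_le_christoffel_succ (hs0 : s 0 = 1) (n : ℕ) (x : ℝ) :
    1 ≤ christoffel s (n + 1) x := by
  have : (P s 0).eval x ^ 2 ≤ christoffel s (n + 1) x :=
    Finset.single_le_sum (f := fun k => (P s k).eval x ^ 2) (fun k _ => sq_nonneg _)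
      (Finset.mem_range.2 n.succ_pos)
  simpa [P_zero hs0] using this

theorem one_le_christoffel (hs0 : s 0 = 1) {n : ℕ} (hn : 0 < n) (x : ℝ) :
    1 ≤ christoffel s n x := by
  obtain ⟨m, rfl⟩ := Nat.exists_eq_succ_of_ne_zero hn.ne'
  exact one_le_christoffel_succ hs0 m x

theorem aeval_conj (p : ℝ[X]) (z : ℂ) :
    aeval (starRingEnd ℂ z) p = starRingEnd ℂ (aeval z p) := by
  have := aeval_algHom_apply (Complex.conjAe : ℂ →ₐ[ℝ] ℂ) z p
  simpa using this

/-- Christoffel-Darboux at `z` and its conjugate: the left side vanishes, while the right side is `z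
- z̄` times a sum of squares that is at least `1`. -/
theorem im_eq_zero_of_aeval_P (hp : PosDef s) (hs0 : s 0 = 1) {n : ℕ} {z : ℂ}
    (h : aeval z (P s n) = 0) : z.im = 0 := by
  cases n with
  | zero => simp [aeval_P_zero hs0] at h
  | succ n =>
    have h1 := casorati_P_P hp hs0 z (starRingEnd ℂ z) n
    have h2 : aeval (starRingEnd ℂ z) (P s (n + 1)) = 0 := by rw [aeval_conj, h, map_zero]
    simp only [casorati, h, h2, zero_mul, mul_zero, sub_zero] at h1
    have h3 : ∑ k ∈ Finset.range (n + 1), aeval z (P s k) * aeval (starRingEnd ℂ z) (P s k) =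
        ((∑ k ∈ Finset.range (n + 1), ‖aeval z (P s k)‖ ^ 2 : ℝ) : ℂ) := by
      rw [Complex.ofReal_sum]
      refine Finset.sum_congr rfl fun k _ => ?_
      rw [aeval_conj, Complex.mul_conj, Complex.normSq_eq_norm_sq]
    have h4 : (1 : ℝ) ≤ ∑ k ∈ Finset.range (n + 1), ‖aeval z (P s k)‖ ^ 2 := by
      have := Finset.single_le_sum (f := fun k => ‖aeval z (P s k)‖ ^ 2) (fun k _ => sq_nonneg _)
        (Finset.mem_range.2 n.succ_pos)
      simpa [aeval_P_zero hs0] using this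
    rw [h3] at h1
    rcases mul_eq_zero.1 h1.symm with h5 | h5
    · rw [Complex.sub_conj] at h5
      simpa using h5
    · exact absurd (Complex.ofReal_eq_zero.1 h5) (by linarith)

theorem splits_P (hp : PosDef s) (hs0 : s 0 = 1) (n : ℕ) : (P s n).Splits := by
  refine Splits.of_splits_map (algebraMap ℝ ℂ) (IsAlgClosed.splits _) fun z hz => ?_
  have h0 : (P s n).map (algebraMap ℝ ℂ) ≠ 0 := by
    rw [Polynomial.map_ne_zero_iff (algebraMap ℝ ℂ).injective]
    exact P_ne_zero hp n
  rw [mem_roots h0, IsRoot, eval_map_algebraMap] at hz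
  exact ⟨z.re, Complex.ext rfl (by simpa using (im_eq_zero_of_aeval_P hp hs0 hz).symm)⟩

theorem aeval_real (x : ℝ) (p : ℝ[X]) : aeval x p = p.eval x :=
  Polynomial.coe_aeval_eq_eval x ▸ rfl

/-- The confluent Christoffel-Darboux formula. -/
theorem confluent_christoffel_darboux (hp : PosDef s) (hs0 : s 0 = 1) (n : ℕ) (x : ℝ) :
    jacobiB s n * ((P s (n + 1)).derivative.eval x * (P s n).eval x -
      (P s n).derivative.eval x * (P s (n + 1)).eval x) = christoffel s (n + 1) x := by
  -- The second argument is frozen at `x`, so this is an identity of polynomials in the first one;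
  -- differentiating it at `x` gives the claim.
  have h : C (jacobiB s n) * (P s (n + 1) * C ((P s n).eval x) - P s n * C ((P s (n + 1)).eval x)) =
      (X - C x) * ∑ k ∈ Finset.range (n + 1), P s k * C ((P s k).eval x) := by
    refine Polynomial.funext fun z => ?_
    have := casorati_P_P hp hs0 z x n
    simp only [casorati, aeval_real, Algebra.algebraMap_self, RingHom.id_apply] at this
    simpa [eval_finsetSum] using this
  have h2 := congrArg (fun p => p.derivative.eval x) h
  simp only [derivative_mul, derivative_sub, derivative_C, derivative_X, eval_mul, eval_add,
    eval_sub, eval_C, eval_X, eval_zero, eval_one, eval_finsetSum, derivative_sum] at h2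
  rw [christoffel]
  simp only [sq]
  linear_combination h2

theorem nodup_roots_P (hp : PosDef s) (hs0 : s 0 = 1) (n : ℕ) : (P s n).roots.Nodup := by
  rw [Multiset.nodup_iff_count_le_one]
  intro x
  rw [count_roots]
  by_contra! h
  have h1 := (one_lt_rootMultiplicity_iff_isRoot (P_ne_zero hp n)).1 h
  cases n with
  | zero => simp [P_zero hs0] at h1
  | succ n =>
    have h2 := confluent_christoffel_darboux hp hs0 n x
    rw [h1.1.eq_zero, h1.2.eq_zero] at h2
    have := one_le_christoffel_succ hs0 n x
    linarith

/-- For a root `x ≤ 0`, write `P n = (X - x) q`. Then `q * P n` is nonnegative on the half-line and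
has positive moment value, against orthogonality. -/
theorem IndetS.root_pos (hs : IndetS s) {n : ℕ} {x : ℝ} (hx : (P s n).eval x = 0) : 0 < x := by
  have hp := hs.posDef
  by_contra! hx0
  obtain ⟨q, hq⟩ := dvd_iff_isRoot.2 hx
  have hPne := P_ne_zero hp n
  have hq0 : q ≠ 0 := fun h => hPne (by rw [hq, h, mul_zero])
  have hdeg : q.degree < n := by
    rw [← degree_P hp n, hq, degree_mul, degree_X_sub_C, degree_eq_natDegree hq0]
    exact_mod_cast (by omega : q.natDegree < 1 + q.natDegree)
  have h1 := momentFun_mul_P_eq_zero hp hdeg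
  have h2 : 0 < momentFun s (q * P s n) := by
    refine hs.momentFun_pos (fun t ht => ?_) (mul_ne_zero hq0 hPne)
    rw [hq, eval_mul, eval_mul, eval_sub, eval_X, eval_C]
    have h3 : 0 ≤ t - x := by linarith
    nlinarith [mul_nonneg h3 (mul_self_nonneg (q.eval t))]
  exact h2.ne' h1

/-! ### Enumeration and interlacing of the zeros -/

theorem length_sort_roots (hp : PosDef s) (hs0 : s 0 = 1) (n : ℕ) :
    ((P s n).roots.sort (· ≤ ·)).length = n := by
  rw [Multiset.length_sort, ← (splits_P hp hs0 n).natDegree_eq_card_roots, natDegree_P hp]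

theorem polyZero_eq (hp : PosDef s) (hs0 : s 0 = 1) {n k : ℕ} (hk : k < n) :
    polyZero s n k = ((P s n).roots.sort (· ≤ ·))[k]'(by rwa [length_sort_roots hp hs0]) := by
  rw [polyZero, List.getD_eq_getElem]

theorem eval_polyZero (hp : PosDef s) (hs0 : s 0 = 1) {n k : ℕ} (hk : k < n) :
    (P s n).eval (polyZero s n k) = 0 := by
  rw [polyZero_eq hp hs0 hk]
  have := List.getElem_mem (l := (P s n).roots.sort (· ≤ ·)) (n := k)
    (by rwa [length_sort_roots hp hs0])
  rw [Multiset.mem_sort, mem_roots (P_ne_zero hp n)] at this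
  exact this

theorem exists_polyZero_eq (hp : PosDef s) (hs0 : s 0 = 1) {n : ℕ} {x : ℝ}
    (hx : (P s n).eval x = 0) : ∃ k < n, polyZero s n k = x := by
  have : x ∈ (P s n).roots.sort (· ≤ ·) := by
    rw [Multiset.mem_sort, mem_roots (P_ne_zero hp n)]
    exact hx
  obtain ⟨k, hk, h⟩ := List.getElem_of_mem this
  rw [length_sort_roots hp hs0] at hk
  exact ⟨k, hk, by rw [polyZero_eq hp hs0 hk, h]⟩

theorem polyZero_lt (hp : PosDef s) (hs0 : s 0 = 1) {n i j : ℕ} (hij : i < j) (hj : j < n) :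
    polyZero s n i < polyZero s n j := by
  have hle : polyZero s n i ≤ polyZero s n j := by
    rw [polyZero_eq hp hs0 hj, polyZero_eq hp hs0 (hij.trans hj)]
    exact List.pairwise_iff_getElem.1 ((P s n).roots.pairwise_sort (· ≤ ·)) i j _ _ hij
  refine hle.lt_of_ne fun h => hij.ne ?_
  rw [polyZero_eq hp hs0 hj, polyZero_eq hp hs0 (hij.trans hj)] at h
  have hnd : ((P s n).roots.sort (· ≤ ·)).Nodup := by
    rw [← Multiset.coe_nodup, Multiset.sort_eq]
    exact nodup_roots_P hp hs0 n
  exact (hnd.getElem_inj_iff).1 h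

/-- Otherwise Rolle's theorem applies to `P (n + 1) / P n` on `[x, y]`, but its derivative has the
sign of the positive Christoffel sum. -/
theorem exists_root_between (hp : PosDef s) (hs0 : s 0 = 1) {n : ℕ} {x y : ℝ} (hxy : x < y)
    (hx : (P s (n + 1)).eval x = 0) (hy : (P s (n + 1)).eval y = 0) :
    ∃ z, x < z ∧ z < y ∧ (P s n).eval z = 0 := by
  by_contra! hcon
  have hb := jacobiB_pos hp n
  have hend : ∀ w, (P s (n + 1)).eval w = 0 → (P s n).eval w ≠ 0 := by
    intro w hw h
    have h1 := confluent_christoffel_darboux hp hs0 n w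
    rw [hw, h] at h1
    have := one_le_christoffel_succ hs0 n w
    linarith
  have hne : ∀ w ∈ Set.Icc x y, (P s n).eval w ≠ 0 := by
    intro w hw
    rcases hw.1.eq_or_lt with rfl | h1
    · exact hend _ hx
    rcases hw.2.eq_or_lt with rfl | h2
    · exact hend _ hy
    exact hcon w h1 h2
  obtain ⟨c, hc, hc0⟩ := exists_hasDerivAt_eq_zero
    (f := fun w => (P s (n + 1)).eval w / (P s n).eval w)
    (f' := fun w => ((P s (n + 1)).derivative.eval w * (P s n).eval w -
      (P s (n + 1)).eval w * (P s n).derivative.eval w) / (P s n).eval w ^ 2) hxy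
    ((P s (n + 1)).continuous.continuousOn.div (P s n).continuous.continuousOn hne)
    (by simp only [hx, hy, zero_div])
    (fun w hw => ((P s (n + 1)).hasDerivAt w).div ((P s n).hasDerivAt w)
      (hne w (Set.Ioo_subset_Icc_self hw)))
  have h1 := confluent_christoffel_darboux hp hs0 n c
  have h2 := one_le_christoffel_succ hs0 n c
  rw [div_eq_zero_iff] at hc0
  rcases hc0 with h | h
  · have : jacobiB s n * ((P s (n + 1)).derivative.eval c * (P s n).eval c -
      (P s n).derivative.eval c * (P s (n + 1)).eval c) = 0 := by
      rw [mul_comm ((P s n).derivative.eval c), h, mul_zero]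
    linarith
  · exact hne c (Set.Ioo_subset_Icc_self hc) (pow_eq_zero_iff two_ne_zero |>.1 h)

/-- Interlacing: the `k`-th zero decreases with the degree. -/
theorem polyZero_succ_lt (hp : PosDef s) (hs0 : s 0 = 1) {n k : ℕ} (hk : k < n) :
    polyZero s (n + 1) k < polyZero s n k := by
  have h : ∀ i : Fin n, ∃ j : Fin n, polyZero s (n + 1) i < polyZero s n j ∧
      polyZero s n j < polyZero s (n + 1) (i + 1) := by
    intro i
    obtain ⟨z, h1, h2, h3⟩ := exists_root_between hp hs0
      (polyZero_lt hp hs0 (Nat.lt_succ_self (i : ℕ)) (by omega : (i : ℕ) + 1 < n + 1))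
      (eval_polyZero hp hs0 (by omega)) (eval_polyZero hp hs0 (by omega))
    obtain ⟨j, hj, rfl⟩ := exists_polyZero_eq hp hs0 h3
    exact ⟨⟨j, hj⟩, h1, h2⟩
  choose f hf using h
  have hmono : StrictMono f := by
    intro i j hij
    have hij' : (i : ℕ) + 1 ≤ j := hij
    have h1 : polyZero s (n + 1) (i + 1) ≤ polyZero s (n + 1) j := by
      rcases hij'.eq_or_lt with h | h
      · rw [h]
      · exact (polyZero_lt hp hs0 h (by omega)).le
    have h2 : polyZero s n (f i) < polyZero s n (f j) :=
      (hf i).2.trans_le (h1.trans (hf j).1.le)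
    by_contra! h3
    rcases h3.eq_or_lt with h | h
    · rw [h] at h2; exact lt_irrefl _ h2
    · exact lt_asymm h2 (polyZero_lt hp hs0 h (f i).2)
  -- The `n` gaps between consecutive zeros of `P (n + 1)` receive zeros of `P n` in increasing
  -- order; a strictly increasing self-map of `Fin n` is the identity.
  have hid : f = id := (hmono.range_inj strictMono_id).1
    (by rw [(Finite.surjective_of_injective hmono.injective).range_eq, Set.range_id])
  have := (hf ⟨k, hk⟩).1
  rwa [hid] at this

/-! ### Signs on the negative half-line -/

theorem neg_one_pow_mul_prod_pos (m : Multiset ℝ) {x : ℝ} (h : ∀ r ∈ m, x < r) :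
    0 < (-1) ^ m.card * (m.map fun r => x - r).prod := by
  induction m using Multiset.induction_on with
  | empty => simp
  | cons a m ih =>
    have h1 := ih fun r hr => h r (Multiset.mem_cons_of_mem hr)
    have h2 := sub_pos.2 (h a (Multiset.mem_cons_self a m))
    rw [Multiset.card_cons, Multiset.map_cons, Multiset.prod_cons, pow_succ]
    have := mul_pos h2 h1
    linarith

theorem IndetS.neg_one_pow_mul_eval_P_pos (hs : IndetS s) (hs0 : s 0 = 1) (n : ℕ) {x : ℝ}
    (hx : x ≤ 0) : 0 < (-1) ^ n * (P s n).eval x := by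
  have hp := hs.posDef
  have hsp := splits_P hp hs0 n
  have hc : (P s n).roots.card = n := by
    rw [← hsp.natDegree_eq_card_roots, natDegree_P hp]
  have h1 := neg_one_pow_mul_prod_pos (P s n).roots (x := x) fun r hr =>
    hx.trans_lt (hs.root_pos ((mem_roots (P_ne_zero hp n)).1 hr))
  rw [hc] at h1
  rw [hsp.eval_eq_prod_roots]
  have := mul_pos (leadingCoeff_P_pos hp n) h1
  linarith

theorem IndetS.eval_P_ne_zero (hs : IndetS s) (n : ℕ) {x : ℝ} (hx : x ≤ 0) :
    (P s n).eval x ≠ 0 := fun h => (hs.root_pos h).not_ge hx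

theorem IndetS.eval_P_mul_pos (hs : IndetS s) (hs0 : s 0 = 1) (n : ℕ) {x y : ℝ}
    (hx : x ≤ 0) (hy : y ≤ 0) : 0 < (P s n).eval x * (P s n).eval y := by
  have := mul_pos (hs.neg_one_pow_mul_eval_P_pos hs0 n hx) (hs.neg_one_pow_mul_eval_P_pos hs0 n hy)
  have e : ((-1 : ℝ) ^ n) * (-1) ^ n = 1 := by rw [← mul_pow]; norm_num
  nlinarith

theorem IndetS.eval_P_succ_mul_neg (hs : IndetS s) (hs0 : s 0 = 1) (n : ℕ) {x : ℝ}
    (hx : x ≤ 0) : (P s (n + 1)).eval x * (P s n).eval x < 0 := by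
  have := mul_pos (hs.neg_one_pow_mul_eval_P_pos hs0 (n + 1) hx)
    (hs.neg_one_pow_mul_eval_P_pos hs0 n hx)
  have e : ((-1 : ℝ) ^ n) * (-1) ^ n = 1 := by rw [← mul_pow]; norm_num
  rw [pow_succ] at this
  nlinarith

/-! ### Gauss quadrature -/

/-- The Gauss quadrature weights. -/
noncomputable def weight (s : ℕ → ℝ) (n j : ℕ) : ℝ := (christoffel s n (polyZero s n j))⁻¹

theorem weight_pos (hs0 : s 0 = 1) {n : ℕ} (hn : 0 < n) (j : ℕ) : 0 < weight s n j :=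
  inv_pos.2 (one_pos.trans_le (one_le_christoffel hs0 hn _))

theorem sum_P_polyZero_eq_zero (hp : PosDef s) (hs0 : s 0 = 1) {n i j : ℕ} (hi : i < n)
    (hj : j < n) (hij : i ≠ j) :
    ∑ k ∈ Finset.range n, (P s k).eval (polyZero s n i) * (P s k).eval (polyZero s n j) = 0 := by
  obtain ⟨m, rfl⟩ := Nat.exists_eq_succ_of_ne_zero (Nat.ne_zero_of_lt hi)
  have h := casorati_P_P hp hs0 (polyZero s (m + 1) i) (polyZero s (m + 1) j) m
  simp only [casorati, aeval_real, eval_polyZero hp hs0 hi, eval_polyZero hp hs0 hj, zero_mul,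
    mul_zero, sub_zero] at h
  refine (mul_eq_zero.1 h.symm).resolve_left (sub_ne_zero.2 ?_)
  rcases lt_or_gt_of_ne hij with h' | h'
  · exact (polyZero_lt hp hs0 h' hj).ne
  · exact (polyZero_lt hp hs0 h' hi).ne'

/-- The matrix `√(weight) P_k(x_j)` has orthonormal rows by Christoffel-Darboux at the nodes; being
square, it also has orthonormal columns. -/
theorem sum_weight_P_P (hp : PosDef s) (hs0 : s 0 = 1) {n k l : ℕ} (hk : k < n) (hl : l < n) :
    ∑ j ∈ Finset.range n, weight s n j * ((P s k).eval (polyZero s n j) *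
      (P s l).eval (polyZero s n j)) = if k = l then 1 else 0 := by
  have hw : ∀ j, 0 < weight s n j := weight_pos hs0 (Nat.zero_lt_of_lt hk)
  let U : Matrix (Fin n) (Fin n) ℝ :=
    Matrix.of fun j k => √(weight s n j) * (P s k).eval (polyZero s n j)
  have h1 : U * U.transpose = 1 := by
    ext i j
    rw [Matrix.mul_apply, Matrix.one_apply]
    have e : ∑ k : Fin n, U i k * U.transpose k j = √(weight s n i) * √(weight s n j) *
        ∑ k ∈ Finset.range n, (P s k).eval (polyZero s n i) * (P s k).eval (polyZero s n j) := by
      rw [Finset.sum_range, Finset.mul_sum]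
      refine Finset.sum_congr rfl fun k _ => ?_
      simp only [U, Matrix.of_apply, Matrix.transpose_apply]
      ring
    rw [e]
    split_ifs with hij
    · rw [← hij, Real.mul_self_sqrt (hw i).le]
      simp only [← sq]
      rw [weight, christoffel]
      refine inv_mul_cancel₀ ?_
      exact (one_pos.trans_le (one_le_christoffel hs0 (Nat.zero_lt_of_lt hk) _)).ne'
    · rw [sum_P_polyZero_eq_zero hp hs0 i.2 j.2 (fun h => hij (Fin.ext h)), mul_zero]
  have h1' : U.transpose * U = 1 := mul_eq_one_comm.1 h1
  have h2 := congrFun (congrFun h1' ⟨k, hk⟩) ⟨l, hl⟩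
  rw [Matrix.mul_apply, Matrix.one_apply] at h2
  rw [Finset.sum_range]
  simp only [Fin.mk.injEq] at h2
  rw [← h2]
  refine Finset.sum_congr rfl fun j _ => ?_
  simp only [U, Matrix.of_apply, Matrix.transpose_apply]
  linear_combination -((P s k).eval (polyZero s n j) * (P s l).eval (polyZero s n j)) *
    Real.mul_self_sqrt (hw j).le

theorem sum_weight_P (hp : PosDef s) (hs0 : s 0 = 1) {n k : ℕ} (hk : k < n) :
    ∑ j ∈ Finset.range n, weight s n j * (P s k).eval (polyZero s n j) =
      if k = 0 then 1 else 0 := by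
  have := sum_weight_P_P hp hs0 hk (Nat.zero_lt_of_lt hk)
  simpa [P_zero hs0] using this

theorem quadrature (hp : PosDef s) (hs0 : s 0 = 1) {n : ℕ} {f : ℝ[X]} (hf : f.degree < n) :
    ∑ j ∈ Finset.range n, weight s n j * f.eval (polyZero s n j) = momentFun s f := by
  have h1 : ∀ k, momentFun s (P s k) = if k = 0 then 1 else 0 := fun k => by
    rw [← momentFun_P_mul_P hp k 0, P_zero hs0, mul_one]
  rw [expansion hp hf, momentFun_sum]
  simp only [momentFun_C_mul, h1, eval_finsetSum, eval_mul, eval_C, Finset.mul_sum]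
  rw [Finset.sum_comm]
  refine Finset.sum_congr rfl fun k hk => ?_
  rw [← sum_weight_P hp hs0 (Finset.mem_range.1 hk), Finset.mul_sum]
  exact Finset.sum_congr rfl fun j _ => by ring

theorem quadrature_pow (hp : PosDef s) (hs0 : s 0 = 1) {n r : ℕ} (hr : r < n) :
    ∑ j ∈ Finset.range n, weight s n j * polyZero s n j ^ r = s r := by
  have := quadrature hp hs0 (n := n) (f := X ^ r) (by rw [degree_X_pow]; exact_mod_cast hr)
  simpa [momentFun_X_pow] using this

/-- The discrete analogue of `integral_P_mul_resolvent` for the Gauss measure. The sum `h n`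
vanishes because the nodes are the zeros of `P n`, so `-Q_n/P_n` is the Stieltjes transform of that
measure. -/
theorem quadrature_resolvent (hp : PosDef s) (hs0 : s 0 = 1) {n : ℕ} (hn : 0 < n) {z : ℂ}
    (hz : ∀ j < n, (polyZero s n j : ℂ) - z ≠ 0) :
    aeval z (Q s n) + (∑ j ∈ Finset.range n, (weight s n j : ℂ) * ((polyZero s n j : ℂ) - z)⁻¹) *
      aeval z (P s n) = 0 := by
  set h : ℕ → ℂ := fun k => ∑ j ∈ Finset.range n, (weight s n j : ℂ) *
    (aeval (polyZero s n j : ℂ) (P s k) * ((polyZero s n j : ℂ) - z)⁻¹) with hh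
  have hsum : ∀ k < n, ∑ j ∈ Finset.range n, (weight s n j : ℂ) *
      aeval (polyZero s n j : ℂ) (P s k) = if k = 0 then 1 else 0 := by
    intro k hk
    have := congrArg (fun r : ℝ => (r : ℂ)) (sum_weight_P hp hs0 hk)
    simp only [aeval_ofReal]
    push_cast at this
    rw [this]
    split_ifs <;> simp
  have hX : ∀ k < n, ∑ j ∈ Finset.range n, (weight s n j : ℂ) *
      ((polyZero s n j : ℂ) * aeval (polyZero s n j : ℂ) (P s k) *
        ((polyZero s n j : ℂ) - z)⁻¹) = z * h k + if k = 0 then 1 else 0 := by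
    intro k hk
    rw [← hsum k hk, hh]
    simp only [Finset.mul_sum]
    rw [← Finset.sum_add_distrib]
    refine Finset.sum_congr rfl fun j hj => ?_
    have := hz j (Finset.mem_range.1 hj)
    field_simp
    ring
  have h0 : h 0 = ∑ j ∈ Finset.range n, (weight s n j : ℂ) * ((polyZero s n j : ℂ) - z)⁻¹ := by
    simp only [hh, aeval_P_zero hs0, one_mul]
  have hn0 : h n = 0 := by
    refine Finset.sum_eq_zero fun j hj => ?_
    rw [aeval_ofReal, eval_polyZero hp hs0 (Finset.mem_range.1 hj)]
    simp
  rw [← h0, ← eq_Q_add_mul_P hp hs0 z h n ?_ ?_ le_rfl, hn0]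
  · intro _
    have h1 := hX 0 hn
    rw [if_pos rfl] at h1
    rw [← h1]
    simp only [hh, Finset.mul_sum]
    rw [← Finset.sum_add_distrib]
    refine Finset.sum_congr rfl fun j _ => ?_
    have h2 := jacobiB_mul_aeval_P_one hp hs0 (polyZero s n j : ℂ)
    rw [aeval_P_zero hs0]
    linear_combination -(weight s n j : ℂ) * ((polyZero s n j : ℂ) - z)⁻¹ * h2
  · intro k hk
    have h1 := hX (k + 1) hk
    rw [if_neg (Nat.succ_ne_zero k), add_zero] at h1
    rw [← h1]
    simp only [hh, Finset.mul_sum]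
    rw [← Finset.sum_add_distrib, ← Finset.sum_add_distrib]
    refine Finset.sum_congr rfl fun j _ => ?_
    have h2 := isRec_P hp (polyZero s n j : ℂ) k
    linear_combination (weight s n j : ℂ) * ((polyZero s n j : ℂ) - z)⁻¹ * h2

/-! ### The parameter `α(s)` -/

/-- Quadrature at `z = 0` gives `Q_n(0) = -(∑ weight/node) P_n(0)`, and all nodes are positive. -/
theorem IndetS.eval_P_mul_eval_Q_neg (hs : IndetS s) (hs0 : s 0 = 1) {n : ℕ} (hn : 0 < n) :
    (P s n).eval 0 * (Q s n).eval 0 < 0 := by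
  have hp := hs.posDef
  have hpos : ∀ j < n, 0 < polyZero s n j := fun j hj => hs.root_pos (eval_polyZero hp hs0 hj)
  have h := quadrature_resolvent hp hs0 hn (z := ((0 : ℝ) : ℂ)) fun j hj => by
    rw [← Complex.ofReal_sub, sub_zero]
    exact_mod_cast (hpos j hj).ne'
  rw [aeval_ofReal, aeval_ofReal] at h
  simp only [← Complex.ofReal_sub, ← Complex.ofReal_inv, ← Complex.ofReal_mul,
    ← Complex.ofReal_sum, ← Complex.ofReal_add, Complex.ofReal_eq_zero, sub_zero] at h
  have h1 : 0 < ∑ j ∈ Finset.range n, weight s n j * (polyZero s n j)⁻¹ :=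
    Finset.sum_pos (fun j hj => mul_pos (weight_pos hs0 hn j)
      (inv_pos.2 (hpos j (Finset.mem_range.1 hj)))) ⟨0, Finset.mem_range.2 hn⟩
  have h2 := mul_pos h1 (hs.eval_P_mul_pos hs0 n le_rfl (le_refl (0 : ℝ)))
  rw [eq_neg_of_add_eq_zero_left h]
  linarith

theorem IndetS.eval_Q_ne_zero (hs : IndetS s) (hs0 : s 0 = 1) {n : ℕ} (hn : 0 < n) :
    (Q s n).eval 0 ≠ 0 := fun h => by
  have := hs.eval_P_mul_eval_Q_neg hs0 hn
  rw [h, mul_zero] at this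
  exact lt_irrefl _ this

theorem IndetS.ratio_neg (hs : IndetS s) (hs0 : s 0 = 1) {n : ℕ} (hn : 0 < n) :
    (P s n).eval 0 / (Q s n).eval 0 < 0 :=
  div_neg_iff.2 (mul_neg_iff.1 (hs.eval_P_mul_eval_Q_neg hs0 hn))

/-- The difference of consecutive ratios is a Casorati determinant, of known sign by
`casorati_self`, over `Q_n(0) Q_{n+1}(0)`, which is negative since the signs alternate. -/
theorem IndetS.ratio_le_succ (hs : IndetS s) (hs0 : s 0 = 1) {n : ℕ} (hn : 0 < n) :
    (P s n).eval 0 / (Q s n).eval 0 ≤ (P s (n + 1)).eval 0 / (Q s (n + 1)).eval 0 := by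
  have hp := hs.posDef
  have hQ := hs.eval_Q_ne_zero hs0 hn
  have hQ' := hs.eval_Q_ne_zero hs0 n.succ_pos
  have h := casorati_self hp hs0 (0 : ℝ) n
  simp only [aeval_real, Algebra.algebraMap_self, RingHom.id_apply] at h
  have h1 := hs.eval_P_mul_eval_Q_neg hs0 hn
  have h2 := hs.eval_P_mul_eval_Q_neg hs0 n.succ_pos
  have h3 := hs.eval_P_succ_mul_neg hs0 n (le_refl (0 : ℝ))
  have hQQ : (Q s (n + 1)).eval 0 * (Q s n).eval 0 < 0 := by
    by_contra! hcon
    have h4 := mul_pos_of_neg_of_neg h1 h2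
    have h5 := mul_nonneg hcon (neg_nonneg.2 h3.le)
    nlinarith
  have hpos : 0 < (Q s (n + 1)).eval 0 * (P s n).eval 0 -
      (Q s n).eval 0 * (P s (n + 1)).eval 0 :=
    pos_of_mul_pos_right (by rw [h]; exact one_pos) (jacobiB_pos hp n).le
  rw [← sub_nonneg, div_sub_div _ _ hQ' hQ]
  refine div_nonneg_of_nonpos ?_ hQQ.le
  linarith

theorem IndetS.tendsto_alpha (hs : IndetS s) (hs0 : s 0 = 1) :
    Tendsto (fun n : ℕ => (P s n).eval 0 / (Q s n).eval 0) atTop (𝓝 (alpha s)) := by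
  -- The shift by one skips `n = 0`, where `Q 0 = 0` and the quotient is a default value.
  have hmono : Monotone fun n : ℕ => (P s (n + 1)).eval 0 / (Q s (n + 1)).eval 0 :=
    monotone_nat_of_le_succ fun n => hs.ratio_le_succ hs0 n.succ_pos
  have h := tendsto_atTop_ciSup hmono ⟨0, by
    rintro _ ⟨n, rfl⟩
    exact (hs.ratio_neg hs0 n.succ_pos).le⟩
  have h' := (tendsto_add_atTop_iff_nat
    (f := fun n : ℕ => (P s n).eval 0 / (Q s n).eval 0) 1).1 h
  rw [alpha]
  exact tendsto_nhds_limUnder ⟨_, h'⟩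

theorem IndetS.alpha_nonpos (hs : IndetS s) (hs0 : s 0 = 1) : alpha s ≤ 0 :=
  le_of_tendsto (hs.tendsto_alpha hs0) (eventually_atTop.2
    ⟨1, fun _ hn => (hs.ratio_neg hs0 hn).le⟩)

end StieltjesMoment

namespace StieltjesMoment

/-! ### Locally uniform convergence of the Nevanlinna functions -/

variable {s : ℕ → ℝ} {v : ℕ → ℝ}

/-- The polynomials `F n` are dominated by multiples of `v n`, locally uniformly. -/
def DomBy (F : ℕ → ℝ[X]) (v : ℕ → ℝ) : Prop :=
  ∀ R : ℝ, ∃ M : ℝ, 0 ≤ M ∧ ∀ z : ℂ, ‖z‖ ≤ R → ∀ n, ‖aeval z (F n)‖ ≤ M * v n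

theorem Dominated.domBy_P (h : Dominated s v) : DomBy (P s) v := fun R => by
  obtain ⟨M, hM, h⟩ := h.2.2 R
  exact ⟨M, hM, fun z hz n => (h z hz n).1⟩

theorem Dominated.domBy_Q (h : Dominated s v) : DomBy (Q s) v := fun R => by
  obtain ⟨M, hM, h⟩ := h.2.2 R
  exact ⟨M, hM, fun z hz n => (h z hz n).2⟩

theorem DomBy.norm_mul_le {F G : ℕ → ℝ[X]} (hF : DomBy F v) (hG : DomBy G v)
    (hv : ∀ n, 0 ≤ v n) (R : ℝ) : ∃ M : ℝ, 0 ≤ M ∧ ∀ z w : ℂ, ‖z‖ ≤ R → ‖w‖ ≤ R → ∀ n,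
      ‖aeval z (F n) * aeval w (G n)‖ ≤ M * v n ^ 2 := by
  obtain ⟨M, hM, h1⟩ := hF R
  obtain ⟨N, hN, h2⟩ := hG R
  refine ⟨M * N, mul_nonneg hM hN, fun z w hz hw n => ?_⟩
  rw [norm_mul]
  calc _ ≤ (M * v n) * (N * v n) :=
        mul_le_mul (h1 z hz n) (h2 w hw n) (norm_nonneg _) (mul_nonneg hM (hv n))
    _ = _ := by ring

theorem DomBy.summable_norm_sq {F : ℕ → ℝ[X]} (hF : DomBy F v)
    (hv2 : Summable fun n => v n ^ 2) (z : ℂ) : Summable fun n => ‖aeval z (F n)‖ ^ 2 := by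
  obtain ⟨M, hM, h⟩ := hF ‖z‖
  refine Summable.of_nonneg_of_le (fun n => by positivity) (fun n => ?_) (hv2.mul_left (M ^ 2))
  rw [← mul_pow]
  exact pow_le_pow_left₀ (norm_nonneg _) (h z le_rfl n) 2

theorem DomBy.summable_mul {F G : ℕ → ℝ[X]} (hF : DomBy F v) (hG : DomBy G v)
    (hv : ∀ n, 0 ≤ v n) (hv2 : Summable fun n => v n ^ 2) (z w : ℂ) :
    Summable fun n => aeval z (F n) * aeval w (G n) := by
  obtain ⟨M, _, h⟩ := hF.norm_mul_le hG hv (max ‖z‖ ‖w‖)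
  exact Summable.of_norm_bounded (hv2.mul_left M) (h z w (le_max_left _ _) (le_max_right _ _))

theorem eventually_norm_le_add_one {ι : Type*} {l : Filter ι} {z : ι → ℂ} {a : ℂ}
    (h : Tendsto z l (𝓝 a)) : ∀ᶠ i in l, ‖z i‖ ≤ ‖a‖ + 1 :=
  (h.norm.eventually (eventually_lt_nhds (lt_add_one ‖a‖))).mono fun _ h => h.le

/-- Dominated convergence with the arguments and the truncation index all varying; this generality
lets the moving zeros of `P n` be inserted. -/
theorem DomBy.tendsto_sum {F G : ℕ → ℝ[X]} (hF : DomBy F v) (hG : DomBy G v)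
    (hv : ∀ n, 0 ≤ v n) (hv2 : Summable fun n => v n ^ 2) {ι : Type*} {l : Filter ι}
    {z w : ι → ℂ} {a b : ℂ} {N : ι → ℕ} (hz : Tendsto z l (𝓝 a)) (hw : Tendsto w l (𝓝 b))
    (hN : Tendsto N l atTop) :
    Tendsto (fun i => ∑ k ∈ Finset.range (N i), aeval (z i) (F k) * aeval (w i) (G k)) l
      (𝓝 (∑' k, aeval a (F k) * aeval b (G k))) := by
  obtain ⟨M, hM0, hM⟩ := hF.norm_mul_le hG hv (max (‖a‖ + 1) (‖b‖ + 1))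
  have key := tendsto_tsum_of_dominated_convergence (𝓕 := l) (hv2.mul_left M)
    (f := fun i k => if k < N i then aeval (z i) (F k) * aeval (w i) (G k) else 0)
    (g := fun k => aeval a (F k) * aeval b (G k)) ?_ ?_
  · refine key.congr fun i => ?_
    rw [tsum_eq_sum (s := Finset.range (N i)) fun k hk => if_neg (by simpa using hk)]
    exact Finset.sum_congr rfl fun k hk => if_pos (Finset.mem_range.1 hk)
  · intro k
    have h1 : Tendsto (fun i => aeval (z i) (F k) * aeval (w i) (G k)) l
        (𝓝 (aeval a (F k) * aeval b (G k))) :=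
      (((F k).continuous_aeval.tendsto a).comp hz).mul (((G k).continuous_aeval.tendsto b).comp hw)
    refine h1.congr' ?_
    filter_upwards [hN.eventually_gt_atTop k] with i hi
    rw [if_pos hi]
  · filter_upwards [eventually_norm_le_add_one hz, eventually_norm_le_add_one hw] with i h1 h2 k
    split_ifs
    · exact hM _ _ (h1.trans (le_max_left _ _)) (h2.trans (le_max_right _ _)) k
    · rw [norm_zero]
      exact mul_nonneg hM0 (sq_nonneg _)

theorem DomBy.tendsto_tsum {F G : ℕ → ℝ[X]} (hF : DomBy F v) (hG : DomBy G v)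
    (hv : ∀ n, 0 ≤ v n) (hv2 : Summable fun n => v n ^ 2) {ι : Type*} {l : Filter ι}
    {z w : ι → ℂ} {a b : ℂ} (hz : Tendsto z l (𝓝 a)) (hw : Tendsto w l (𝓝 b)) :
    Tendsto (fun i => ∑' k, aeval (z i) (F k) * aeval (w i) (G k)) l
      (𝓝 (∑' k, aeval a (F k) * aeval b (G k))) := by
  obtain ⟨M, hM0, hM⟩ := hF.norm_mul_le hG hv (max (‖a‖ + 1) (‖b‖ + 1))
  refine tendsto_tsum_of_dominated_convergence (hv2.mul_left M) (fun k => ?_) ?_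
  · exact (((F k).continuous_aeval.tendsto a).comp hz).mul
      (((G k).continuous_aeval.tendsto b).comp hw)
  · filter_upwards [eventually_norm_le_add_one hz, eventually_norm_le_add_one hw] with i h1 h2 k
    exact hM _ _ (h1.trans (le_max_left _ _)) (h2.trans (le_max_right _ _)) k

theorem DomBy.differentiable_tsum {F G : ℕ → ℝ[X]} (hF : DomBy F v) (hG : DomBy G v)
    (hv : ∀ n, 0 ≤ v n) (hv2 : Summable fun n => v n ^ 2) (b : ℂ) :
    Differentiable ℂ fun z => ∑' k, aeval z (F k) * aeval b (G k) := by
  intro z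
  obtain ⟨M, hM0, hM⟩ := hF.norm_mul_le hG hv (max (‖z‖ + 1) ‖b‖)
  have := Complex.differentiableOn_tsum_of_summable_norm (U := Metric.ball 0 (‖z‖ + 1))
    (F := fun k z => aeval z (F k) * aeval b (G k)) (hv2.mul_left M)
    (fun k => ((F k).differentiable_aeval.mul_const _).differentiableOn) Metric.isOpen_ball
    (fun k w hw => hM w b ((mem_ball_zero_iff.1 hw).le.trans (le_max_left _ _))
      (le_max_right _ _) k)
  exact this.differentiableAt (Metric.isOpen_ball.mem_nhds (by simp))

theorem Dominated.differentiable_nevB (h : Dominated s v) : Differentiable ℂ (nevB s) := by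
  have := h.domBy_P.differentiable_tsum h.domBy_Q h.1 h.2.1 0
  unfold nevB
  fun_prop

theorem Dominated.differentiable_nevD (h : Dominated s v) : Differentiable ℂ (nevD s) := by
  have := h.domBy_P.differentiable_tsum h.domBy_P h.1 h.2.1 0
  unfold nevD
  fun_prop

theorem Dominated.tendsto_nevA (h : Dominated s v) (hp : PosDef s) {z : ℕ → ℂ} {a : ℂ}
    (hz : Tendsto z atTop (𝓝 a)) :
    Tendsto (fun n => casorati s n (fun k => aeval (z n) (Q s k)) fun k => aeval (0 : ℂ) (Q s k))
      atTop (𝓝 (nevA s a)) := by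
  simp only [casorati_Q_Q hp, sub_zero]
  exact hz.mul (h.domBy_Q.tendsto_sum h.domBy_Q h.1 h.2.1 hz tendsto_const_nhds
    (tendsto_add_atTop_nat 1))

theorem Dominated.tendsto_nevB (h : Dominated s v) (hp : PosDef s) (hs0 : s 0 = 1) {z : ℕ → ℂ}
    {a : ℂ} (hz : Tendsto z atTop (𝓝 a)) :
    Tendsto (fun n => casorati s n (fun k => aeval (z n) (P s k)) fun k => aeval (0 : ℂ) (Q s k))
      atTop (𝓝 (nevB s a)) := by
  simp only [casorati_P_Q hp hs0, sub_zero]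
  exact tendsto_const_nhds.add (hz.mul (h.domBy_P.tendsto_sum h.domBy_Q h.1 h.2.1 hz
    tendsto_const_nhds (tendsto_add_atTop_nat 1)))

theorem Dominated.tendsto_nevC (h : Dominated s v) (hp : PosDef s) (hs0 : s 0 = 1) {z : ℕ → ℂ}
    {a : ℂ} (hz : Tendsto z atTop (𝓝 a)) :
    Tendsto (fun n => casorati s n (fun k => aeval (z n) (Q s k)) fun k => aeval (0 : ℂ) (P s k))
      atTop (𝓝 (nevC s a)) := by
  simp only [casorati_Q_P hp hs0, sub_zero]
  exact tendsto_const_nhds.add (hz.mul (h.domBy_Q.tendsto_sum h.domBy_P h.1 h.2.1 hz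
    tendsto_const_nhds (tendsto_add_atTop_nat 1)))

theorem Dominated.tendsto_nevD (h : Dominated s v) (hp : PosDef s) (hs0 : s 0 = 1) {z : ℕ → ℂ}
    {a : ℂ} (hz : Tendsto z atTop (𝓝 a)) :
    Tendsto (fun n => casorati s n (fun k => aeval (z n) (P s k)) fun k => aeval (0 : ℂ) (P s k))
      atTop (𝓝 (nevD s a)) := by
  simp only [casorati_P_P hp hs0, sub_zero]
  exact hz.mul (h.domBy_P.tendsto_sum h.domBy_P h.1 h.2.1 hz tendsto_const_nhds
    (tendsto_add_atTop_nat 1))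

theorem Dominated.nev_det (h : Dominated s v) (hp : PosDef s) (hs0 : s 0 = 1) (z : ℂ) :
    nevA s z * nevD s z - nevB s z * nevC s z = 1 := by
  have hz : Tendsto (fun _ : ℕ => z) atTop (𝓝 z) := tendsto_const_nhds
  have := ((h.tendsto_nevA hp hz).mul (h.tendsto_nevD hp hs0 hz)).sub
    ((h.tendsto_nevB hp hs0 hz).mul (h.tendsto_nevC hp hs0 hz))
  simp only [nevanlinna_det hp hs0] at this
  exact tendsto_nhds_unique this tendsto_const_nhds

theorem IndetS.aeval_Q_ne_zero (hs : IndetS s) (hs0 : s 0 = 1) (n : ℕ) :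
    aeval (0 : ℂ) (Q s (n + 1)) ≠ 0 := by
  rw [← Complex.ofReal_zero, aeval_ofReal]
  exact_mod_cast hs.eval_Q_ne_zero hs0 n.succ_pos

theorem IndetS.tendsto_alpha_complex (hs : IndetS s) (hs0 : s 0 = 1) :
    Tendsto (fun n : ℕ => aeval (0 : ℂ) (P s (n + 1)) / aeval (0 : ℂ) (Q s (n + 1))) atTop
      (𝓝 (alpha s : ℂ)) := by
  have h1 := (Complex.continuous_ofReal.tendsto _).comp
    ((tendsto_add_atTop_iff_nat 1).2 (hs.tendsto_alpha hs0))
  refine h1.congr fun n => ?_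
  rw [← Complex.ofReal_zero, aeval_ofReal, aeval_ofReal]
  simp

/-- Variation of constants based at `0` reads `P_{n+1}(z) = D_n Q_{n+1}(0) - B_n P_{n+1}(0)`; divide
by `-Q_{n+1}(0)`. -/
theorem IndetS.tendsto_P_div (hs : IndetS s) (hs0 : s 0 = 1) (h : Dominated s v) {z : ℕ → ℂ}
    {a : ℂ} (hz : Tendsto z atTop (𝓝 a)) :
    Tendsto (fun n => -(aeval (z n) (P s (n + 1)) / aeval (0 : ℂ) (Q s (n + 1)))) atTop
      (𝓝 (nevB s a * alpha s - nevD s a)) := by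
  have hp := hs.posDef
  refine (((h.tendsto_nevB hp hs0 hz).mul (hs.tendsto_alpha_complex hs0)).sub
    (h.tendsto_nevD hp hs0 hz)).congr fun n => ?_
  have hQ := hs.aeval_Q_ne_zero hs0 n
  have e := variation_of_constants hp hs0 0 (fun k => aeval (z n) (P s k)) n
  rw [e]
  field_simp
  ring

theorem IndetS.tendsto_Q_div (hs : IndetS s) (hs0 : s 0 = 1) (h : Dominated s v) {z : ℕ → ℂ}
    {a : ℂ} (hz : Tendsto z atTop (𝓝 a)) :
    Tendsto (fun n => -(aeval (z n) (Q s (n + 1)) / aeval (0 : ℂ) (Q s (n + 1)))) atTop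
      (𝓝 (nevA s a * alpha s - nevC s a)) := by
  have hp := hs.posDef
  refine (((h.tendsto_nevA hp hz).mul (hs.tendsto_alpha_complex hs0)).sub
    (h.tendsto_nevC hp hs0 hz)).congr fun n => ?_
  have hQ := hs.aeval_Q_ne_zero hs0 n
  have e := variation_of_constants hp hs0 0 (fun k => aeval (z n) (Q s k)) n
  rw [e]
  field_simp
  ring

end StieltjesMoment

namespace StieltjesMoment

/-! ### Strict negativity of `α(s)` -/

variable {s : ℕ → ℝ} {v : ℕ → ℝ} {μ : Measure ℝ}

theorem IsSolution.integrable_mul_inv (h : IsSolution s μ) (hμ : μ (Set.Iio 0) = 0) {x : ℝ}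
    (hx : x < 0) (p : ℝ[X]) : Integrable (fun t => p.eval t * (t - x)⁻¹) μ := by
  have := (h.integrable_mul_resolvent (away_of_re_neg hμ (z := (x : ℂ)) (by simpa using hx)) p).re
  refine this.congr (Eventually.of_forall fun t => ?_)
  simp only [← Complex.ofReal_sub, ← Complex.ofReal_inv, ← Complex.ofReal_mul,
    RCLike.re_to_complex, Complex.ofReal_re]

theorem IsSolution.integral_P_mul_inv (hp : PosDef s) (hs0 : s 0 = 1) (h : IsSolution s μ)
    (hμ : μ (Set.Iio 0) = 0) {x : ℝ} (hx : x < 0) (n : ℕ) :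
    ∫ t, (P s n).eval t * (t - x)⁻¹ ∂μ =
      (Q s n).eval x + (∫ t, (t - x)⁻¹ ∂μ) * (P s n).eval x := by
  have := h.integral_P_mul_resolvent hp hs0
    (away_of_re_neg hμ (z := (x : ℂ)) (by simpa using hx)) n
  rw [aeval_ofReal, aeval_ofReal] at this
  simp only [← Complex.ofReal_sub, ← Complex.ofReal_inv, ← Complex.ofReal_mul,
    integral_complex_ofReal, ← Complex.ofReal_add] at this
  exact_mod_cast this

/-- Replacing `p(x)` by `p(t) - (t - x) q(t)` under the integral changes it only by the term killed
by `h0`, leaving `∫ p² g/(t - x) ≥ 0`. It gives the lower bound with `g = 1` and the upper bound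
with `g = X`. -/
theorem IsSolution.eval_mul_integral_nonneg (h : IsSolution s μ) (hμ : μ (Set.Iio 0) = 0) {x : ℝ}
    (hx : x < 0) {p g q : ℝ[X]} (hq : p - C (p.eval x) = (X - C x) * q)
    (hg : ∀ t, 0 ≤ t → 0 ≤ g.eval t) (h0 : momentFun s (p * (g * q)) = 0) :
    0 ≤ p.eval x * ∫ t, (p * g).eval t * (t - x)⁻¹ ∂μ := by
  have key : p.eval x * ∫ t, (p * g).eval t * (t - x)⁻¹ ∂μ =
      ∫ t, (p * p * g).eval t * (t - x)⁻¹ ∂μ := by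
    rw [← integral_const_mul, ← sub_zero (∫ t, (p * p * g).eval t * (t - x)⁻¹ ∂μ), ← h0,
      ← h.integral_eval, ← integral_sub (h.integrable_mul_inv hμ hx _) (h.integrable_eval _)]
    refine integral_congr_ae ?_
    filter_upwards [ae_nonneg_of_measure_Iio hμ] with t ht
    have hne : t - x ≠ 0 := by linarith
    have e := congrArg (eval t) hq
    simp only [eval_sub, eval_C, eval_mul, eval_X] at e ⊢
    field_simp
    linear_combination (-(p.eval t * g.eval t)) * e
  rw [key]
  refine integral_nonneg_of_ae ?_
  filter_upwards [ae_nonneg_of_measure_Iio hμ] with t ht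
  have : 0 ≤ (t - x)⁻¹ := inv_nonneg.2 (by linarith)
  simp only [eval_mul]
  exact mul_nonneg (mul_nonneg (mul_self_nonneg _) (hg t ht)) this

theorem exists_divided_difference (p : ℝ[X]) (x : ℝ) {n : ℕ} (hn : p.natDegree ≤ n + 1) :
    ∃ q : ℝ[X], p - C (p.eval x) = (X - C x) * q ∧ q.natDegree ≤ n := by
  obtain ⟨q, hq⟩ := X_sub_C_dvd_sub_C_eval (a := x) (p := p)
  refine ⟨q, hq, ?_⟩
  by_cases hq0 : q = 0
  · simp [hq0]
  have h1 : ((X - C x) * q).natDegree = 1 + q.natDegree := by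
    rw [natDegree_mul (X_sub_C_ne_zero x) hq0, natDegree_X_sub_C]
  rw [← hq, natDegree_sub_C] at h1
  omega

/-- The lower bound for the Stieltjes transform on the negative axis. -/
theorem IsSolution.eval_P_mul_nonneg (hp : PosDef s) (hs0 : s 0 = 1) (h : IsSolution s μ)
    (hμ : μ (Set.Iio 0) = 0) {x : ℝ} (hx : x < 0) (n : ℕ) :
    0 ≤ (P s (n + 1)).eval x * ((Q s (n + 1)).eval x +
      (∫ t, (t - x)⁻¹ ∂μ) * (P s (n + 1)).eval x) := by
  obtain ⟨q, hq, hd⟩ := exists_divided_difference (P s (n + 1)) x (natDegree_P hp (n + 1)).le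
  have := h.eval_mul_integral_nonneg hμ hx (g := 1) hq (by simp) (by
    rw [one_mul, mul_comm]
    refine momentFun_mul_P_eq_zero hp (degree_le_natDegree.trans_lt ?_)
    exact_mod_cast Nat.lt_succ_of_le hd)
  rwa [mul_one, h.integral_P_mul_inv hp hs0 hμ hx] at this

/-- The polynomial `∑_{k ≤ n} P_k(0) P_k`. -/
noncomputable def kernelZero (s : ℕ → ℝ) (n : ℕ) : ℝ[X] :=
  ∑ k ∈ Finset.range (n + 1), C ((P s k).eval 0) * P s k

/-- The reproducing property: the kernel polynomial represents evaluation at `0` in degree at most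
`n`. -/
theorem momentFun_kernelZero_mul (hp : PosDef s) {n : ℕ} {f : ℝ[X]} (hf : f.natDegree ≤ n) :
    momentFun s (kernelZero s n * f) = f.eval 0 := by
  have hd : f.degree < ((n + 1 : ℕ) : WithBot ℕ) :=
    degree_le_natDegree.trans_lt (by exact_mod_cast Nat.lt_succ_of_le hf)
  conv_rhs => rw [expansion hp hd]
  rw [kernelZero, Finset.sum_mul, momentFun_sum, eval_finsetSum]
  refine Finset.sum_congr rfl fun k _ => ?_
  rw [mul_assoc, momentFun_C_mul, eval_mul, eval_C, mul_comm f, mul_comm]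

theorem eval_kernelZero (n : ℕ) (x : ℝ) : (kernelZero s n).eval x =
    ∑ k ∈ Finset.range (n + 1), (P s k).eval x * (P s k).eval 0 := by
  rw [kernelZero, eval_finsetSum]
  exact Finset.sum_congr rfl fun k _ => by rw [eval_mul, eval_C, mul_comm]

theorem IndetS.one_le_eval_kernelZero (hs : IndetS s) (hs0 : s 0 = 1) (n : ℕ) {x : ℝ}
    (hx : x ≤ 0) : 1 ≤ (kernelZero s n).eval x := by
  rw [eval_kernelZero]
  have := Finset.single_le_sum (f := fun k => (P s k).eval x * (P s k).eval 0)
    (fun k _ => (hs.eval_P_mul_pos hs0 k hx le_rfl).le) (Finset.mem_range.2 n.succ_pos)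
  simpa [P_zero hs0] using this

/-- The upper bound for the Stieltjes transform on the negative axis. -/
theorem IndetS.stieltjes_upper (hs : IndetS s) (hs0 : s 0 = 1) (h : IsSolution s μ)
    (hμ : μ (Set.Iio 0) = 0) {x : ℝ} (hx : x < 0) (n : ℕ) :
    0 ≤ casorati s n (fun k => aeval x (Q s k)) (fun k => aeval (0 : ℝ) (P s k)) +
      (∫ t, (t - x)⁻¹ ∂μ) *
        casorati s n (fun k => aeval x (P s k)) (fun k => aeval (0 : ℝ) (P s k)) := by
  have hp := hs.posDef
  have hdeg : (kernelZero s n).natDegree ≤ n := by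
    refine natDegree_sum_le_of_forall_le _ _ fun k hk => ?_
    refine (natDegree_C_mul_le _ _).trans ?_
    rw [natDegree_P hp]
    exact Nat.lt_succ_iff.1 (Finset.mem_range.1 hk)
  have hpos := hs.one_le_eval_kernelZero hs0 n hx.le
  -- The product `X * q` must stay in the reproducing range; it vanishes at `0`, which yields the
  -- orthogonality hypothesis below. For `n = 0` the kernel is constant and `q = 0` works.
  obtain ⟨q, hq, hqz⟩ : ∃ q : ℝ[X], kernelZero s n - C ((kernelZero s n).eval x) =
      (X - C x) * q ∧ (X * q).natDegree ≤ n := by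
    rcases n with _ | n
    · refine ⟨0, ?_, by simp⟩
      rw [eq_C_of_natDegree_le_zero hdeg]
      simp
    · obtain ⟨q, h1, h2⟩ := exists_divided_difference (kernelZero s (n + 1)) x hdeg
      exact ⟨q, h1, (natDegree_mul_le).trans (by rw [natDegree_X]; omega)⟩
  have h1 := h.eval_mul_integral_nonneg hμ hx (g := X) hq (by simp) (by
    rw [momentFun_kernelZero_mul hp hqz]
    simp)
  have h2 := nonneg_of_mul_nonneg_right h1 (by linarith)
  have h3 : ∫ t, (kernelZero s n * X).eval t * (t - x)⁻¹ ∂μ =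
      1 + x * ∫ t, (kernelZero s n).eval t * (t - x)⁻¹ ∂μ := by
    have e1 : ∫ t, (kernelZero s n).eval t ∂μ = 1 := by
      have := momentFun_kernelZero_mul hp (f := 1) (n := n) (by simp)
      rw [h.integral_eval, ← mul_one (kernelZero s n), this, eval_one]
    rw [← integral_const_mul, ← e1,
      ← integral_add (h.integrable_eval _) ((h.integrable_mul_inv hμ hx _).const_mul x)]
    refine integral_congr_ae ?_
    filter_upwards [ae_nonneg_of_measure_Iio hμ] with t ht
    have hne : t - x ≠ 0 := by linarith
    simp only [eval_mul, eval_X]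
    field_simp
    ring
  have h4 : ∫ t, (kernelZero s n).eval t * (t - x)⁻¹ ∂μ = ∑ k ∈ Finset.range (n + 1),
      ((Q s k).eval x + (∫ t, (t - x)⁻¹ ∂μ) * (P s k).eval x) * (P s k).eval 0 := by
    simp only [kernelZero, eval_finsetSum, Finset.sum_mul, eval_mul, eval_C, mul_assoc]
    rw [integral_finsetSum _ fun k _ => (h.integrable_mul_inv hμ hx (P s k)).const_mul _]
    refine Finset.sum_congr rfl fun k _ => ?_
    rw [integral_const_mul, h.integral_P_mul_inv hp hs0 hμ hx, mul_comm]
  rw [casorati_Q_P hp hs0, casorati_P_P hp hs0]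
  simp only [aeval_real, sub_zero]
  rw [h3, h4] at h2
  refine h2.trans_eq ?_
  simp only [add_mul, Finset.sum_add_distrib, mul_assoc, ← Finset.mul_sum]
  ring

theorem DomBy.summable_eval_mul {F G : ℕ → ℝ[X]} (hF : DomBy F v) (hG : DomBy G v)
    (hv : ∀ n, 0 ≤ v n) (hv2 : Summable fun n => v n ^ 2) (x y : ℝ) :
    Summable fun n => (F n).eval x * (G n).eval y := by
  have := hF.summable_mul hG hv hv2 x y
  simp only [aeval_ofReal, ← Complex.ofReal_mul] at this
  exact Complex.summable_ofReal.1 this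

/-- If `α = 0`, the bounds `-Q_{n+1}/P_{n+1}` and `-C_n/D_n` for the transforms at `x < 0` have the
same limit, so all half-line solutions coincide. -/
theorem IndetS.alpha_neg (hs : IndetS s) (hs0 : s 0 = 1) : alpha s < 0 := by
  refine (hs.alpha_nonpos hs0).lt_of_ne fun hα => ?_
  have hp := hs.posDef
  obtain ⟨v, hv⟩ := hs.exists_dominated hs0
  have hlim := hs.tendsto_alpha hs0
  have hs' := hs
  obtain ⟨μ₁, μ₂, h1, h2, hn1, hn2, hne⟩ := hs'
  have := h1.isFiniteMeasure
  have := h2.isFiniteMeasure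
  suffices H : ∀ κ₁ κ₂ : Measure ℝ, IsSolution s κ₁ → IsSolution s κ₂ → κ₁ (Set.Iio 0) = 0 →
      κ₂ (Set.Iio 0) = 0 → ∀ x : ℝ, x < 0 → ∫ t, (t - x)⁻¹ ∂κ₂ ≤ ∫ t, (t - x)⁻¹ ∂κ₁ by
    refine hne (measure_ext_of_stieltjes_neg (by rw [h1.real_univ, h2.real_univ]) hn1 hn2
      fun x hx => le_antisymm ?_ ?_)
    · exact H _ _ h2 h1 hn2 hn1 x hx
    · exact H _ _ h1 h2 hn1 hn2 x hx
  intro κ₁ κ₂ k1 k2 kn1 kn2 x hx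
  set B : ℕ → ℝ := fun n =>
    casorati s n (fun k => aeval x (P s k)) (fun k => aeval (0 : ℝ) (Q s k)) with hB
  set D : ℕ → ℝ := fun n =>
    casorati s n (fun k => aeval x (P s k)) (fun k => aeval (0 : ℝ) (P s k)) with hD
  obtain ⟨b, hb⟩ : ∃ b, Tendsto B atTop (𝓝 b) := by
    have := ((hv.domBy_P.summable_eval_mul hv.domBy_Q hv.1 hv.2.1 x 0).hasSum.tendsto_sum_nat.comp
      (tendsto_add_atTop_nat 1)).const_mul x |>.const_add (-1)
    refine ⟨_, this.congr fun n => ?_⟩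
    simp only [hB, casorati_P_Q hp hs0, sub_zero]
    simp only [aeval_real, Function.comp]
  obtain ⟨d, hd⟩ : ∃ d, Tendsto D atTop (𝓝 d) := by
    have := ((hv.domBy_P.summable_eval_mul hv.domBy_P hv.1 hv.2.1 x 0).hasSum.tendsto_sum_nat.comp
      (tendsto_add_atTop_nat 1)).const_mul x
    refine ⟨_, this.congr fun n => ?_⟩
    simp only [hD, casorati_P_P hp hs0, sub_zero]
    simp only [aeval_real, Function.comp]
  have hDle : ∀ n, D n ≤ x := by
    intro n
    simp only [hD, casorati_P_P hp hs0, sub_zero]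
    simp only [aeval_real]
    rw [← eval_kernelZero]
    nlinarith [hs.one_le_eval_kernelZero hs0 n hx.le]
  have hd0 : d < 0 := (le_of_tendsto hd (Eventually.of_forall hDle)).trans_lt hx
  set r : ℕ → ℝ := fun n => (P s (n + 1)).eval 0 / (Q s (n + 1)).eval 0 with hr
  have hrlim : Tendsto r atTop (𝓝 0) := by
    rw [← hα]
    exact (tendsto_add_atTop_iff_nat (f := fun n : ℕ => (P s n).eval 0 / (Q s n).eval 0) 1).2 hlim
  -- This expression is the upper bound minus the lower bound (`e6`). The denominator stays away
  -- from `0` because `D_n ≤ x < 0`.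
  have hgap : Tendsto (fun n => -(r n / (D n * (D n - B n * r n)))) atTop (𝓝 0) := by
    have h3 : Tendsto (fun n => D n * (D n - B n * r n)) atTop (𝓝 (d * (d - b * 0))) :=
      hd.mul (hd.sub (hb.mul hrlim))
    have := (hrlim.div h3 (by simpa using hd0.ne)).neg
    simpa using this
  rw [← sub_nonpos]
  refine ge_of_tendsto' hgap fun n => ?_
  have hQ0 := hs.eval_Q_ne_zero hs0 n.succ_pos
  have lower := k1.eval_P_mul_nonneg hp hs0 kn1 hx n
  have upper := hs.stieltjes_upper hs0 k2 kn2 hx n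
  have e1 := variation_of_constants hp hs0 (0 : ℝ) (fun k => aeval x (P s k)) n
  have e2 := variation_of_constants hp hs0 (0 : ℝ) (fun k => aeval x (Q s k)) n
  have e3 := nevanlinna_det hp hs0 x (0 : ℝ) n
  have hPx := hs.eval_P_ne_zero (n + 1) hx.le
  change 0 ≤ _ + _ * D n at upper
  change (aeval x (P s (n + 1)) : ℝ) = D n * _ - B n * _ at e1
  change _ * D n - B n * _ = 1 at e3
  set Cn := casorati s n (fun k => aeval x (Q s k)) (fun k => aeval (0 : ℝ) (P s k))
  set An := casorati s n (fun k => aeval x (Q s k)) (fun k => aeval (0 : ℝ) (Q s k))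
  simp only [aeval_real] at e1 e2
  have hDn : D n < 0 := (hDle n).trans_lt hx
  have e4 : Cn * (P s (n + 1)).eval x - D n * (Q s (n + 1)).eval x = (P s (n + 1)).eval 0 := by
    rw [e1, e2]
    linear_combination (P s (n + 1)).eval 0 * e3
  have e5 : D n - B n * r n = (P s (n + 1)).eval x / (Q s (n + 1)).eval 0 := by
    rw [e1, hr]
    field_simp
  have e6 : -(r n / (D n * (D n - B n * r n))) =
      -(Cn / D n) + (Q s (n + 1)).eval x / (P s (n + 1)).eval x := by
    rw [e5, hr]
    have := hDn.ne
    field_simp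
    linear_combination e4
  rw [e6]
  have l1 : -((Q s (n + 1)).eval x / (P s (n + 1)).eval x) ≤ ∫ t, (t - x)⁻¹ ∂κ₁ := by
    have hsq : 0 < (P s (n + 1)).eval x ^ 2 := by positivity
    have : 0 ≤ (P s (n + 1)).eval x ^ 2 * ((Q s (n + 1)).eval x / (P s (n + 1)).eval x +
        ∫ t, (t - x)⁻¹ ∂κ₁) := by
      refine lower.trans_eq ?_
      field_simp
    linarith [nonneg_of_mul_nonneg_right this hsq]
  have u1 : ∫ t, (t - x)⁻¹ ∂κ₂ ≤ -(Cn / D n) := by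
    rw [← neg_div, le_div_iff_of_neg hDn]
    linarith
  linarith

end StieltjesMoment

namespace StieltjesMoment

/-! ### The quotient `D / B` along the negative axis -/

variable {s : ℕ → ℝ} {v : ℕ → ℝ}

/-- Weighted means of a convergent sequence, the weights escaping to infinity. -/
theorem tendsto_weighted_mean {ι : Type*} {l : Filter ι} {c : ℕ → ι → ℝ} {γ : ℕ → ℝ} {b : ℝ}
    (hpos : ∀ᶠ x in l, ∀ k, 0 < c k x) (hsum : ∀ᶠ x in l, Summable fun k => c k x)
    (hratio : ∀ k N, k < N → Tendsto (fun x => c k x / c N x) l (𝓝 0))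
    (hγ : Tendsto γ atTop (𝓝 b)) :
    Tendsto (fun x => (∑' k, γ k * c k x) / ∑' k, c k x) l (𝓝 b) := by
  obtain ⟨M, hM⟩ : ∃ M, ∀ k, |γ k - b| ≤ M := by
    obtain ⟨M, hM⟩ := (hγ.sub_const b).norm.bddAbove_range
    exact ⟨M, fun k => hM ⟨k, rfl⟩⟩
  rw [Metric.tendsto_nhds]
  intro ε hε
  obtain ⟨N, hN⟩ := Metric.tendsto_atTop.1 hγ (ε / 2) (half_pos hε)
  -- The total weight is at least the single weight `c N`, which dominates each earlier one in the
  -- limit; so the first `N` terms do not matter.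
  have hhead : Tendsto (fun x => M * ∑ k ∈ Finset.range N, c k x / c N x) l (𝓝 0) := by
    have := (tendsto_finsetSum (Finset.range N) fun k hk =>
      hratio k N (Finset.mem_range.1 hk)).const_mul M
    simpa using this
  filter_upwards [hpos, hsum, hhead.eventually (eventually_lt_nhds (half_pos hε))]
    with x hp hs hx
  have hS : 0 < ∑' k, c k x := hs.tsum_pos (fun k => (hp k).le) 0 (hp 0)
  have hbd : ∀ k, ‖(γ k - b) * c k x‖ ≤ M * c k x := fun k => by
    rw [norm_mul, Real.norm_eq_abs, Real.norm_eq_abs, abs_of_pos (hp k)]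
    exact mul_le_mul_of_nonneg_right (hM k) (hp k).le
  have hsγ : Summable fun k => (γ k - b) * c k x := Summable.of_norm_bounded (hs.mul_left M) hbd
  have e1 : ∑' k, γ k * c k x = ∑' k, (γ k - b) * c k x + b * ∑' k, c k x := by
    rw [← tsum_mul_left, ← hsγ.tsum_add (hs.mul_left b)]
    exact tsum_congr fun k => by ring
  have e2 : (∑' k, γ k * c k x) / (∑' k, c k x) - b =
      (∑' k, (γ k - b) * c k x) / ∑' k, c k x := by
    rw [e1]; field_simp; ring
  have hfin : Summable fun k => if k ∈ Finset.range N then M * c k x else 0 :=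
    summable_of_ne_finset_zero (s := Finset.range N) fun k hk => if_neg hk
  have hM0 : 0 ≤ M := (abs_nonneg _).trans (hM 0)
  have e3 : |∑' k, (γ k - b) * c k x| ≤
      ε / 2 * (∑' k, c k x) + M * ∑ k ∈ Finset.range N, c k x := by
    have h1 : ‖∑' k, (γ k - b) * c k x‖ ≤
        ∑' k, (ε / 2 * c k x + if k ∈ Finset.range N then M * c k x else 0) := by
      refine tsum_of_norm_bounded ((hs.mul_left (ε / 2)).add hfin).hasSum fun k => ?_
      split_ifs with hk
      · have := mul_nonneg (half_pos hε).le (hp k).le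
        linarith [hbd k]
      · have h2 := hN k (by simpa using hk)
        rw [Real.dist_eq] at h2
        rw [norm_mul, Real.norm_eq_abs, Real.norm_eq_abs, abs_of_pos (hp k), add_zero]
        exact mul_le_mul_of_nonneg_right h2.le (hp k).le
    rw [(hs.mul_left (ε / 2)).tsum_add hfin, tsum_mul_left,
      tsum_eq_sum (s := Finset.range N) fun k hk => if_neg hk,
      Finset.sum_congr rfl fun k hk => if_pos hk, ← Finset.mul_sum] at h1
    exact h1
  have e4 : (∑ k ∈ Finset.range N, c k x) / (∑' k, c k x) ≤
      ∑ k ∈ Finset.range N, c k x / c N x := by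
    rw [← Finset.sum_div]
    exact div_le_div_of_nonneg_left (Finset.sum_nonneg fun k _ => (hp k).le) (hp N)
      (hs.le_tsum N fun k _ => (hp k).le)
  rw [Real.dist_eq, e2, abs_div, abs_of_pos hS]
  calc _ ≤ (ε / 2 * (∑' k, c k x) + M * ∑ k ∈ Finset.range N, c k x) / ∑' k, c k x :=
        div_le_div_of_nonneg_right e3 hS.le
    _ = ε / 2 + M * ((∑ k ∈ Finset.range N, c k x) / ∑' k, c k x) := by field_simp
    _ ≤ ε / 2 + M * ∑ k ∈ Finset.range N, c k x / c N x := by gcongr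
    _ < ε := by linarith

theorem nevD_ofReal (x : ℝ) :
    nevD s x = ((x * ∑' k, (P s k).eval x * (P s k).eval 0 : ℝ) : ℂ) := by
  rw [nevD, ← Complex.ofReal_zero]
  simp only [aeval_ofReal]
  push_cast
  rfl

theorem nevB_ofReal (x : ℝ) :
    nevB s x = ((-1 + x * ∑' k, (P s k).eval x * (Q s k).eval 0 : ℝ) : ℂ) := by
  rw [nevB, ← Complex.ofReal_zero]
  simp only [aeval_ofReal]
  push_cast
  rfl

/-- `B/D` equals `-1/D` plus the mean of `Q_k(0)/P_k(0)` with positive weights `P_k(x) P_k(0)`. As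
`x → -∞` the weights drift to large `k`, as higher degrees dominate, and `D → -∞`, so the limit is
`1/α`; inverting is allowed since `α ≠ 0`. -/
theorem IndetS.tendsto_nevD_div_nevB (hs : IndetS s) (hs0 : s 0 = 1) :
    Tendsto (fun x : ℝ => nevD s x / nevB s x) atBot (𝓝 (alpha s : ℂ)) := by
  have hp := hs.posDef
  obtain ⟨v, hv⟩ := hs.exists_dominated hs0
  have hα := hs.alpha_neg hs0
  have hsumPP := hv.domBy_P.summable_eval_mul hv.domBy_P hv.1 hv.2.1
  have hposall : ∀ x : ℝ, x < 0 → ∀ k, 0 < (P s k).eval x * (P s k).eval 0 := fun x hx k =>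
    hs.eval_P_mul_pos hs0 k hx.le le_rfl
  have hmean := tendsto_weighted_mean (l := atBot)
    (c := fun k x => (P s k).eval x * (P s k).eval 0)
    (γ := fun k => (Q s k).eval 0 / (P s k).eval 0) (b := (alpha s)⁻¹)
    ((eventually_lt_atBot 0).mono hposall)
    (Eventually.of_forall fun x => hsumPP x 0)
    (fun k N hkN => by
      have h1 := div_tendsto_atBot_zero_of_degree_lt (P s k) (P s N) (by
        rw [degree_P hp, degree_P hp]; exact_mod_cast hkN)
      have := h1.mul_const ((P s k).eval 0 / (P s N).eval 0)
      rw [zero_mul] at this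
      exact this.congr fun x => by rw [div_mul_div_comm])
    (by
      refine ((hs.tendsto_alpha hs0).inv₀ hα.ne).congr fun k => ?_
      rw [inv_div])
  have hD : ∀ x : ℝ, x < 0 → x * ∑' k, (P s k).eval x * (P s k).eval 0 ≤ x := by
    intro x hx
    have : 1 ≤ ∑' k, (P s k).eval x * (P s k).eval 0 := by
      have := (hsumPP x 0).le_tsum 0 fun k _ => (hposall x hx k).le
      simpa [P_zero hs0] using this
    nlinarith
  have hDinf : Tendsto (fun x : ℝ => x * ∑' k, (P s k).eval x * (P s k).eval 0) atBot atBot :=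
    tendsto_atBot_mono' _ ((eventually_lt_atBot 0).mono hD) tendsto_id
  have hBD : Tendsto (fun x : ℝ => (-1 + x * ∑' k, (P s k).eval x * (Q s k).eval 0) /
      (x * ∑' k, (P s k).eval x * (P s k).eval 0)) atBot (𝓝 (alpha s)⁻¹) := by
    have h1 := (hDinf.inv_tendsto_atBot.neg).add hmean
    rw [neg_zero, zero_add] at h1
    refine h1.congr' ?_
    filter_upwards [eventually_lt_atBot 0] with x hx
    have hne : x * ∑' k, (P s k).eval x * (P s k).eval 0 ≠ 0 := by
      have := hD x hx
      linarith
    have e : ∑' k, (Q s k).eval 0 / (P s k).eval 0 * ((P s k).eval x * (P s k).eval 0) =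
        ∑' k, (P s k).eval x * (Q s k).eval 0 := tsum_congr fun k => by
      have := hs.eval_P_ne_zero k (le_refl (0 : ℝ))
      field_simp
    simp only [Pi.inv_apply]
    rw [e]
    have h0 := left_ne_zero_of_mul hne
    have h1 := right_ne_zero_of_mul hne
    field_simp
  have hDB := hBD.inv₀ (inv_ne_zero hα.ne)
  rw [inv_inv] at hDB
  refine ((Complex.continuous_ofReal.tendsto _).comp hDB).congr fun x => ?_
  rw [nevD_ofReal, nevB_ofReal, ← Complex.ofReal_div]
  simp only [Function.comp, inv_div]

end StieltjesMoment

namespace StieltjesMoment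

/-! ### The limits of the zeros -/

variable {s : ℕ → ℝ} {v : ℕ → ℝ}

theorem IndetS.polyZero_pos (hs : IndetS s) (hs0 : s 0 = 1) {n k : ℕ} (hk : k < n) :
    0 < polyZero s n k := hs.root_pos (eval_polyZero hs.posDef hs0 hk)

/-- The offset `k + 1` avoids the dummy values of `polyZero s n k` for `n ≤ k`. -/
theorem IndetS.antitone_polyZero (hs : IndetS s) (hs0 : s 0 = 1) (k : ℕ) :
    Antitone fun n => polyZero s (n + (k + 1)) k :=
  antitone_nat_of_succ_le fun n => by
    rw [Nat.add_right_comm]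
    exact (polyZero_succ_lt hs.posDef hs0 (by omega)).le

theorem IndetS.tendsto_polyZero (hs : IndetS s) (hs0 : s 0 = 1) (k : ℕ) :
    Tendsto (fun n : ℕ => polyZero s n k) atTop (𝓝 (xi s k)) := by
  have h := tendsto_atTop_ciInf (hs.antitone_polyZero hs0 k) ⟨0, by
    rintro _ ⟨n, rfl⟩
    exact (hs.polyZero_pos hs0 (by omega)).le⟩
  rw [xi]
  exact tendsto_nhds_limUnder
    ⟨_, (tendsto_add_atTop_iff_nat (f := fun n : ℕ => polyZero s n k) (k + 1)).1 h⟩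

theorem IndetS.tendsto_polyZero_complex (hs : IndetS s) (hs0 : s 0 = 1) (k : ℕ) :
    Tendsto (fun n : ℕ => (polyZero s n k : ℂ)) atTop (𝓝 (xi s k : ℂ)) :=
  (Complex.continuous_ofReal.tendsto _).comp (hs.tendsto_polyZero hs0 k)

theorem IndetS.xi_le_polyZero (hs : IndetS s) (hs0 : s 0 = 1) {n k : ℕ} (hk : k < n) :
    xi s k ≤ polyZero s n k := by
  obtain ⟨m, rfl⟩ := Nat.exists_eq_add_of_le' hk
  exact (hs.antitone_polyZero hs0 k).le_of_tendsto
    ((tendsto_add_atTop_iff_nat (f := fun n : ℕ => polyZero s n k) (k + 1)).2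
      (hs.tendsto_polyZero hs0 k)) m

theorem IndetS.xi_nonneg (hs : IndetS s) (hs0 : s 0 = 1) (k : ℕ) : 0 ≤ xi s k :=
  ge_of_tendsto (hs.tendsto_polyZero hs0 k)
    ((eventually_gt_atTop k).mono fun _ hn => (hs.polyZero_pos hs0 hn).le)

theorem IndetS.monotone_xi (hs : IndetS s) (hs0 : s 0 = 1) : Monotone (xi s) :=
  monotone_nat_of_le_succ fun k => le_of_tendsto_of_tendsto (hs.tendsto_polyZero hs0 k)
    (hs.tendsto_polyZero hs0 (k + 1)) ((eventually_gt_atTop (k + 1)).mono fun _ hn =>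
      (polyZero_lt hs.posDef hs0 (Nat.lt_succ_self k) hn).le)

theorem IndetS.kernel_xi_eq_zero (hs : IndetS s) (hs0 : s 0 = 1) (hv : Dominated s v) {i j : ℕ}
    (hij : i ≠ j) : ∑' k, aeval (xi s i : ℂ) (P s k) * aeval (xi s j : ℂ) (P s k) = 0 := by
  refine tendsto_nhds_unique (hv.domBy_P.tendsto_sum hv.domBy_P hv.1 hv.2.1
    (hs.tendsto_polyZero_complex hs0 i) (hs.tendsto_polyZero_complex hs0 j) tendsto_id)
    (tendsto_const_nhds.congr' ?_)
  filter_upwards [eventually_gt_atTop i, eventually_gt_atTop j] with n hi hj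
  have := sum_P_polyZero_eq_zero hs.posDef hs0 hi hj hij
  simp only [aeval_ofReal, id]
  exact_mod_cast this.symm

theorem Dominated.one_le_tsum_sq (hv : Dominated s v) (hs0 : s 0 = 1) (x : ℝ) :
    1 ≤ ∑' k, (P s k).eval x * (P s k).eval x := by
  have := (hv.domBy_P.summable_eval_mul hv.domBy_P hv.1 hv.2.1 x x).le_tsum 0
    fun k _ => mul_self_nonneg _
  simpa [P_zero hs0] using this

theorem kernel_ofReal (x : ℝ) : ∑' k, aeval (x : ℂ) (P s k) * aeval (x : ℂ) (P s k) =
    ((∑' k, (P s k).eval x * (P s k).eval x : ℝ) : ℂ) := by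
  simp only [aeval_ofReal]
  push_cast
  rfl

theorem Dominated.kernel_self_ne_zero (hv : Dominated s v) (hs0 : s 0 = 1) (x : ℝ) :
    ∑' k, aeval (x : ℂ) (P s k) * aeval (x : ℂ) (P s k) ≠ 0 := by
  rw [kernel_ofReal]
  exact_mod_cast (one_pos.trans_le (hv.one_le_tsum_sq hs0 x)).ne'

theorem IndetS.strictMono_xi (hs : IndetS s) (hs0 : s 0 = 1) : StrictMono (xi s) := by
  obtain ⟨v, hv⟩ := hs.exists_dominated hs0
  refine (hs.monotone_xi hs0).strictMono_of_injective fun i j hij => ?_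
  by_contra hne
  have := hs.kernel_xi_eq_zero hs0 hv hne
  rw [hij] at this
  exact hv.kernel_self_ne_zero hs0 _ this

/-- At a finite limit `l`, the relations `K(ξ_n, ξ_{n+1}) = 0` would give `K(l, l) = 0` by
continuity. -/
theorem IndetS.tendsto_xi (hs : IndetS s) (hs0 : s 0 = 1) : Tendsto (xi s) atTop atTop := by
  obtain ⟨v, hv⟩ := hs.exists_dominated hs0
  refine (tendsto_atTop_of_monotone (hs.monotone_xi hs0)).resolve_right ?_
  rintro ⟨l, hl⟩
  have h1 : Tendsto (fun n => (xi s n : ℂ)) atTop (𝓝 (l : ℂ)) :=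
    (Complex.continuous_ofReal.tendsto _).comp hl
  have h2 := (tendsto_add_atTop_iff_nat 1).2 h1
  have h3 := hv.domBy_P.tendsto_tsum hv.domBy_P hv.1 hv.2.1 h1 h2
  simp only [hs.kernel_xi_eq_zero hs0 hv (Nat.succ_ne_self _).symm] at h3
  exact hv.kernel_self_ne_zero hs0 l (tendsto_nhds_unique h3 tendsto_const_nhds)

theorem IndetS.nev_xi (hs : IndetS s) (hs0 : s 0 = 1) (hv : Dominated s v) (k : ℕ) :
    nevB s (xi s k) * alpha s - nevD s (xi s k) = 0 := by
  refine tendsto_nhds_unique (hs.tendsto_P_div hs0 hv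
    ((tendsto_add_atTop_iff_nat 1).2 (hs.tendsto_polyZero_complex hs0 k)))
    (tendsto_const_nhds.congr' ?_)
  filter_upwards [eventually_ge_atTop k] with n hn
  rw [aeval_ofReal, eval_polyZero hs.posDef hs0 (Nat.lt_succ_of_le hn)]
  simp

theorem IndetS.xi_pos (hs : IndetS s) (hs0 : s 0 = 1) (k : ℕ) : 0 < xi s k := by
  obtain ⟨v, hv⟩ := hs.exists_dominated hs0
  refine (hs.xi_nonneg hs0 k).lt_of_ne fun h => ?_
  have := hs.nev_xi hs0 hv k
  rw [← h] at this
  simp only [nevB, nevD, Complex.ofReal_zero, zero_mul, add_zero, sub_zero, neg_mul, one_mul,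
    neg_eq_zero, Complex.ofReal_eq_zero] at this
  exact (hs.alpha_neg hs0).ne this

/-- Finitely many indices are handled by convergence; for the others `x_{n,j} ≥ ξ_j ≥ ξ_J ≥ ‖z‖ +
1`, uniformly in `n`. -/
theorem IndetS.exists_gap (hs : IndetS s) (hs0 : s 0 = 1) {z : ℂ}
    (hz : ∀ k, (xi s k : ℂ) ≠ z) :
    ∃ δ > 0, ∀ᶠ n in atTop, ∀ j < n, δ ≤ ‖(polyZero s n j : ℂ) - z‖ := by
  have hfin : ∀ J : ℕ, ∃ δ > 0, ∀ᶠ n in atTop, ∀ j < J, δ ≤ ‖(polyZero s n j : ℂ) - z‖ := by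
    intro J
    induction J with
    | zero => exact ⟨1, one_pos, by simp⟩
    | succ J ih =>
      obtain ⟨δ, hδ, h⟩ := ih
      have hpos : 0 < ‖(xi s J : ℂ) - z‖ := norm_pos_iff.2 (sub_ne_zero.2 (hz J))
      have h2 := ((hs.tendsto_polyZero_complex hs0 J).sub_const z).norm.eventually
        (eventually_gt_nhds (half_lt_self hpos))
      refine ⟨min δ (‖(xi s J : ℂ) - z‖ / 2), lt_min hδ (half_pos hpos), ?_⟩
      filter_upwards [h, h2] with n h3 h4 j hj
      rcases (Nat.lt_succ_iff.1 hj).eq_or_lt with rfl | hj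
      · exact (min_le_right _ _).trans h4.le
      · exact (min_le_left _ _).trans (h3 j hj)
  obtain ⟨J, hJ⟩ := ((hs.tendsto_xi hs0).eventually_ge_atTop (‖z‖ + 1)).exists
  obtain ⟨δ, hδ, h⟩ := hfin J
  refine ⟨min δ 1, lt_min hδ one_pos, ?_⟩
  filter_upwards [h] with n hn j hj
  rcases lt_or_ge j J with h1 | h1
  · exact (min_le_left _ _).trans (hn j h1)
  · refine (min_le_right _ _).trans ?_
    have h2 : ‖z‖ + 1 ≤ polyZero s n j :=
      hJ.trans ((hs.monotone_xi hs0 h1).trans (hs.xi_le_polyZero hs0 hj))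
    have h3 := norm_sub_norm_le (polyZero s n j : ℂ) z
    rw [Complex.norm_real, Real.norm_eq_abs] at h3
    linarith [le_abs_self (polyZero s n j)]

/-- The Gauss weights sum to `1` and the nodes keep distance `δ` from `z`, so `|Q_n(z)| ≤ δ⁻¹
|P_n(z)|`. In the limit a zero of `Bα - D` is also a zero of `Aα - C`, contradicting `AD - BC = 1`.
-/
theorem IndetS.nev_ne_zero (hs : IndetS s) (hs0 : s 0 = 1) (hv : Dominated s v) {z : ℂ}
    (hz : ∀ k, (xi s k : ℂ) ≠ z) : nevB s z * alpha s - nevD s z ≠ 0 := by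
  have hp := hs.posDef
  intro h0
  obtain ⟨δ, hδ, hgap⟩ := hs.exists_gap hs0 hz
  have hz' : Tendsto (fun _ : ℕ => z) atTop (𝓝 z) := tendsto_const_nhds
  have hle : ‖nevA s z * alpha s - nevC s z‖ ≤ δ⁻¹ * ‖nevB s z * alpha s - nevD s z‖ := by
    refine le_of_tendsto_of_tendsto (hs.tendsto_Q_div hs0 hv hz').norm
      ((hs.tendsto_P_div hs0 hv hz').norm.const_mul δ⁻¹) ?_
    filter_upwards [(tendsto_add_atTop_nat 1).eventually hgap] with n hn
    rw [norm_neg, norm_neg, norm_div, norm_div, ← mul_div_assoc]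
    refine div_le_div_of_nonneg_right ?_ (norm_nonneg _)
    have h1 := quadrature_resolvent hp hs0 n.succ_pos (z := z) fun j hj =>
      norm_pos_iff.1 (hδ.trans_le (hn j hj))
    rw [eq_neg_of_add_eq_zero_left h1, norm_neg, norm_mul]
    refine mul_le_mul_of_nonneg_right ?_ (norm_nonneg _)
    have h2 := quadrature_pow hp hs0 (n := n + 1) (r := 0) n.succ_pos
    simp only [pow_zero, mul_one, hs0] at h2
    calc _ ≤ ∑ j ∈ Finset.range (n + 1), weight s (n + 1) j * δ⁻¹ := by
          refine norm_sum_le_of_le _ fun j hj => ?_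
          have hw := weight_pos hs0 n.succ_pos j
          rw [norm_mul, norm_inv, Complex.norm_real, Real.norm_eq_abs, abs_of_pos hw]
          exact mul_le_mul_of_nonneg_left (inv_anti₀ hδ (hn j (Finset.mem_range.1 hj))) hw.le
      _ = δ⁻¹ := by rw [← Finset.sum_mul, h2, one_mul]
  rw [h0, norm_zero, mul_zero, norm_le_zero_iff] at hle
  have hdet := hv.nev_det hp hs0 z
  have : (1 : ℂ) = 0 := by
    rw [← hdet]
    linear_combination nevB s z * hle - nevA s z * h0
  exact one_ne_zero this

theorem IndetS.setOf_nev_eq (hs : IndetS s) (hs0 : s 0 = 1) :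
    {z : ℂ | nevB s z * alpha s - nevD s z = 0} = Set.range fun k : ℕ => (xi s k : ℂ) := by
  obtain ⟨v, hv⟩ := hs.exists_dominated hs0
  ext z
  constructor
  · intro hz
    by_contra hcon
    exact hs.nev_ne_zero hs0 hv (fun k hk => hcon ⟨k, hk⟩) hz
  · rintro ⟨k, rfl⟩
    exact hs.nev_xi hs0 hv k

theorem IndetS.isClosed_range_xi (hs : IndetS s) (hs0 : s 0 = 1) :
    IsClosed (Set.range (xi s)) := by
  obtain ⟨v, hv⟩ := hs.exists_dominated hs0
  have h1 : Set.range (xi s) = (fun x : ℝ => (x : ℂ)) ⁻¹'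
      {z : ℂ | nevB s z * alpha s - nevD s z = 0} := by
    rw [hs.setOf_nev_eq hs0]
    ext x
    simp
  rw [h1]
  refine IsClosed.preimage Complex.continuous_ofReal (isClosed_eq ?_ continuous_const)
  exact (hv.differentiable_nevB.continuous.mul_const _).sub hv.differentiable_nevD.continuous

end StieltjesMoment

namespace StieltjesMoment

/-! ### The Friedrichs solution -/

variable {s : ℕ → ℝ} {v : ℕ → ℝ}

/-- Termwise limits of series whose tails are uniformly small. -/
theorem tendsto_sum_of_uniform_tail {h : ℕ → ℕ → ℂ} {g : ℕ → ℂ}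
    (hlim : ∀ j, Tendsto (fun n => h n j) atTop (𝓝 (g j)))
    (htail : ∀ ε > 0, ∃ J, ∀ᶠ n in atTop, ∑ j ∈ Finset.Ico J n, ‖h n j‖ ≤ ε) :
    (Summable fun j => ‖g j‖) ∧
      Tendsto (fun n => ∑ j ∈ Finset.range n, h n j) atTop (𝓝 (∑' j, g j)) := by
  have hgtail : ∀ ε > 0, ∃ J, (∀ᶠ n in atTop, ∑ j ∈ Finset.Ico J n, ‖h n j‖ ≤ ε) ∧
      ∀ N, ∑ j ∈ Finset.Ico J N, ‖g j‖ ≤ ε := by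
    intro ε hε
    obtain ⟨J, hJ⟩ := htail ε hε
    refine ⟨J, hJ, fun N => ?_⟩
    refine le_of_tendsto (tendsto_finsetSum (Finset.Ico J N) fun j _ => (hlim j).norm) ?_
    filter_upwards [hJ, eventually_ge_atTop N] with n hn hN
    exact (Finset.sum_le_sum_of_subset_of_nonneg (Finset.Ico_subset_Ico_right hN)
      fun _ _ _ => norm_nonneg _).trans hn
  have hsum : Summable fun j => ‖g j‖ := by
    obtain ⟨J, -, hJ⟩ := hgtail 1 one_pos
    refine summable_of_sum_range_le (c := ∑ j ∈ Finset.range J, ‖g j‖ + 1)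
      (fun _ => norm_nonneg _) fun n => ?_
    rcases le_total n J with hn | hn
    · have := Finset.sum_le_sum_of_subset_of_nonneg (Finset.range_mono hn)
        fun j _ _ => norm_nonneg (g j)
      linarith
    · rw [← Finset.sum_range_add_sum_Ico _ hn]
      linarith [hJ n]
  refine ⟨hsum, Metric.tendsto_atTop'.2 fun ε hε => ?_⟩
  obtain ⟨J, hJ, hgJ⟩ := hgtail (ε / 4) (by positivity)
  have hgsum : Summable g := hsum.of_norm
  have htsum : ‖∑' j, g j - ∑ j ∈ Finset.range J, g j‖ ≤ ε / 4 := by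
    refine le_of_tendsto (hgsum.hasSum.tendsto_sum_nat.sub_const _).norm ?_
    filter_upwards [eventually_ge_atTop J] with N hN
    rw [← Finset.sum_range_add_sum_Ico _ hN, add_sub_cancel_left]
    exact (norm_sum_le _ _).trans (hgJ N)
  have hhead : Tendsto (fun n => ∑ j ∈ Finset.range J, h n j) atTop
      (𝓝 (∑ j ∈ Finset.range J, g j)) := tendsto_finsetSum _ fun j _ => hlim j
  obtain ⟨N, hN⟩ := eventually_atTop.1 ((hJ.and (eventually_ge_atTop J)).and
    (Metric.tendsto_nhds.1 hhead (ε / 4) (by positivity)))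
  refine ⟨N, fun n hn => ?_⟩
  obtain ⟨⟨h1, h2⟩, h3⟩ := hN n hn.le
  rw [dist_eq_norm] at h3 ⊢
  have e : ∑ j ∈ Finset.range n, h n j - ∑' j, g j =
      (∑ j ∈ Finset.range J, h n j - ∑ j ∈ Finset.range J, g j) +
        ∑ j ∈ Finset.Ico J n, h n j - (∑' j, g j - ∑ j ∈ Finset.range J, g j) := by
    rw [← Finset.sum_range_add_sum_Ico (fun j => h n j) h2]
    ring
  rw [e]
  have h4 := norm_sum_le (Finset.Ico J n) fun j => h n j
  have h5 := norm_sub_le ((∑ j ∈ Finset.range J, h n j - ∑ j ∈ Finset.range J, g j) +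
    ∑ j ∈ Finset.Ico J n, h n j) (∑' j, g j - ∑ j ∈ Finset.range J, g j)
  have h6 := norm_add_le (∑ j ∈ Finset.range J, h n j - ∑ j ∈ Finset.range J, g j)
    (∑ j ∈ Finset.Ico J n, h n j)
  linarith

/-- The masses of the Friedrichs solution. -/
noncomputable def mass (s : ℕ → ℝ) (j : ℕ) : ℝ :=
  (∑' k, (P s k).eval (xi s j) * (P s k).eval (xi s j))⁻¹

theorem Dominated.mass_pos (hv : Dominated s v) (hs0 : s 0 = 1) (j : ℕ) : 0 < mass s j :=
  inv_pos.2 (one_pos.trans_le (hv.one_le_tsum_sq hs0 _))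

theorem IndetS.tendsto_weight (hs : IndetS s) (hs0 : s 0 = 1) (hv : Dominated s v) (j : ℕ) :
    Tendsto (fun n => (weight s n j : ℂ)) atTop (𝓝 (mass s j : ℂ)) := by
  have h := hv.domBy_P.tendsto_sum hv.domBy_P hv.1 hv.2.1 (hs.tendsto_polyZero_complex hs0 j)
    (hs.tendsto_polyZero_complex hs0 j) tendsto_id
  have h2 := h.inv₀ (hv.kernel_self_ne_zero hs0 _)
  rw [kernel_ofReal, ← Complex.ofReal_inv] at h2
  refine h2.congr fun n => ?_
  simp only [weight, christoffel, aeval_ofReal, id, sq]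
  push_cast
  rfl

/-- Convergence of the Gauss quadratures for functions of polynomial growth. -/
theorem IndetS.tendsto_quadrature (hs : IndetS s) (hs0 : s 0 = 1) (hv : Dominated s v)
    {f : ℝ → ℂ} (hf : ∀ j, ContinuousAt f (xi s j)) {M : ℝ} {r : ℕ} (hM : 0 ≤ M)
    (hbd : ∀ x, 0 ≤ x → ‖f x‖ ≤ M * x ^ r) :
    (Summable fun j => ‖(mass s j : ℂ) * f (xi s j)‖) ∧
      Tendsto (fun n => ∑ j ∈ Finset.range n, (weight s n j : ℂ) * f (polyZero s n j)) atTop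
        (𝓝 (∑' j, (mass s j : ℂ) * f (xi s j))) := by
  have hp := hs.posDef
  refine tendsto_sum_of_uniform_tail (h := fun n j => (weight s n j : ℂ) * f (polyZero s n j))
    (fun j => (hs.tendsto_weight hs0 hv j).mul ((hf j).tendsto.comp (hs.tendsto_polyZero hs0 j)))
    fun ε hε => ?_
  -- For `j ≥ J` the nodes are at least `ξ_J`, so `ξ_J` times the tail is at most `M` times the
  -- quadrature of `x ^ (r + 1)`, which is exact for `n > r + 1`.
  obtain ⟨J, hJ⟩ := ((hs.tendsto_xi hs0).eventually_ge_atTop (M * s (r + 1) / ε)).exists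
  refine ⟨J, ?_⟩
  filter_upwards [eventually_gt_atTop (r + 1)] with n hn
  have hn0 : 0 < n := by omega
  have hxi := hs.xi_pos hs0 J
  have key : xi s J * ∑ j ∈ Finset.Ico J n, ‖(weight s n j : ℂ) * f (polyZero s n j)‖ ≤
      M * s (r + 1) := by
    rw [← quadrature_pow hp hs0 hn, Finset.mul_sum, Finset.mul_sum, Finset.range_eq_Ico]
    refine (Finset.sum_le_sum fun j hj => ?_).trans
      (Finset.sum_le_sum_of_subset_of_nonneg (Finset.Ico_subset_Ico_left (Nat.zero_le J))
        fun j hj _ => ?_)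
    · obtain ⟨h1, h2⟩ := Finset.mem_Ico.1 hj
      have hw := weight_pos hs0 hn0 j
      have hx := hs.polyZero_pos hs0 h2
      have hle : xi s J ≤ polyZero s n j := (hs.monotone_xi hs0 h1).trans (hs.xi_le_polyZero hs0 h2)
      rw [norm_mul, Complex.norm_real, Real.norm_eq_abs, abs_of_pos hw]
      calc xi s J * (weight s n j * ‖f (polyZero s n j)‖)
          ≤ polyZero s n j * (weight s n j * (M * polyZero s n j ^ r)) := by
            gcongr
            exact hbd _ hx.le
        _ = M * (weight s n j * polyZero s n j ^ (r + 1)) := by ring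
    · have hw := weight_pos hs0 hn0 j
      have hx := hs.polyZero_pos hs0 (Finset.mem_Ico.1 hj).2
      positivity
  rw [div_le_iff₀ hε] at hJ
  exact le_of_mul_le_mul_left (key.trans hJ) hxi

/-- The Friedrichs solution. -/
noncomputable def friedrichs (s : ℕ → ℝ) : Measure ℝ :=
  Measure.sum fun j => ENNReal.ofReal (mass s j) • Measure.dirac (xi s j)

theorem Dominated.integrable_friedrichs {E : Type*} [NormedAddCommGroup E] (hv : Dominated s v)
    (hs0 : s 0 = 1) {f : ℝ → E} (hf : StronglyMeasurable f)
    (hsum : Summable fun j => mass s j * ‖f (xi s j)‖) : Integrable f (friedrichs s) := by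
  refine ⟨hf.aestronglyMeasurable, ?_⟩
  rw [HasFiniteIntegral, friedrichs, lintegral_sum_measure]
  simp only [lintegral_smul_measure, lintegral_dirac' _ hf.enorm, smul_eq_mul]
  have e : ∀ j, ENNReal.ofReal (mass s j) * ‖f (xi s j)‖ₑ =
      ENNReal.ofReal (mass s j * ‖f (xi s j)‖) := fun j => by
    rw [ENNReal.ofReal_mul (hv.mass_pos hs0 j).le, ofReal_norm]
  simp only [e]
  exact hsum.tsum_ofReal_lt_top

theorem Dominated.integral_friedrichs {E : Type*} [NormedAddCommGroup E] [NormedSpace ℝ E]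
    [CompleteSpace E] (hv : Dominated s v) (hs0 : s 0 = 1) {f : ℝ → E} (hf : StronglyMeasurable f)
    (hsum : Summable fun j => mass s j * ‖f (xi s j)‖) :
    ∫ x, f x ∂(friedrichs s) = ∑' j, mass s j • f (xi s j) := by
  have h := hasSum_integral_measure (hv.integrable_friedrichs hs0 hf hsum)
  rw [friedrichs, ← h.tsum_eq]
  refine tsum_congr fun j => ?_
  rw [integral_smul_measure, integral_dirac, ENNReal.toReal_ofReal (hv.mass_pos hs0 j).le]

theorem IndetS.isSolution_friedrichs (hs : IndetS s) (hs0 : s 0 = 1) :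
    IsSolution s (friedrichs s) := by
  obtain ⟨v, hv⟩ := hs.exists_dominated hs0
  intro r
  have hmeas : StronglyMeasurable fun x : ℝ => x ^ r := by fun_prop
  obtain ⟨h1, h2⟩ := hs.tendsto_quadrature hs0 hv (f := fun x => ((x ^ r : ℝ) : ℂ))
    (fun j => by fun_prop) (M := 1) (r := r) zero_le_one
    (fun x hx => by rw [Complex.norm_real, Real.norm_eq_abs, abs_of_nonneg (by positivity), one_mul])
  have hsum : Summable fun j => mass s j * ‖xi s j ^ r‖ := h1.congr fun j => by
    rw [norm_mul, Complex.norm_real, Complex.norm_real, Real.norm_of_nonneg (hv.mass_pos hs0 j).le]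
  refine ⟨hv.integrable_friedrichs hs0 hmeas hsum, ?_⟩
  rw [hv.integral_friedrichs hs0 hmeas hsum]
  have h3 : ∑' j, (mass s j : ℂ) * ((xi s j ^ r : ℝ) : ℂ) = (s r : ℂ) := by
    refine tendsto_nhds_unique h2 (tendsto_const_nhds.congr' ?_)
    filter_upwards [eventually_gt_atTop r] with n hn
    rw [← quadrature_pow hs.posDef hs0 hn]
    push_cast
    rfl
  simp only [smul_eq_mul]
  exact_mod_cast h3

theorem IndetS.isFriedrichs_friedrichs (hs : IndetS s) (hs0 : s 0 = 1) :
    IsFriedrichs s (friedrichs s) := by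
  have hp := hs.posDef
  obtain ⟨v, hv⟩ := hs.exists_dominated hs0
  refine ⟨hs.isSolution_friedrichs hs0, fun z hz => ?_⟩
  have hne : ∀ x : ℝ, (x : ℂ) - z ≠ 0 := fun x h => hz (by simpa using congrArg Complex.im h)
  have hcont : Continuous fun x : ℝ => ((x : ℂ) - z)⁻¹ :=
    Continuous.inv₀ (by fun_prop) hne
  obtain ⟨h1, h2⟩ := hs.tendsto_quadrature hs0 hv (f := fun x : ℝ => ((x : ℂ) - z)⁻¹)
    (fun j => hcont.continuousAt) (M := |z.im|⁻¹) (r := 0) (by positivity) (fun x _ => by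
      rw [pow_zero, mul_one, norm_inv]
      refine inv_anti₀ (abs_pos.2 hz) ?_
      simpa using Complex.abs_im_le_norm ((x : ℂ) - z))
  have hsum : Summable fun j => mass s j * ‖((xi s j : ℂ) - z)⁻¹‖ := h1.congr fun j => by
    rw [norm_mul, Complex.norm_real, Real.norm_of_nonneg (hv.mass_pos hs0 j).le]
  rw [hv.integral_friedrichs hs0 hcont.stronglyMeasurable hsum]
  simp only [Complex.real_smul]
  have hPhi := hs.nev_ne_zero hs0 hv (z := z) fun k hk => hne _ (sub_eq_zero.2 hk)
  have hz' : Tendsto (fun _ : ℕ => z) atTop (𝓝 z) := tendsto_const_nhds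
  have h3 := ((hs.tendsto_Q_div hs0 hv hz').div (hs.tendsto_P_div hs0 hv hz') hPhi).neg
  -- The quadrature sums of the resolvent equal `-Q_{n+1}/P_{n+1}`; the common factor `Q_{n+1}(0)`
  -- in the two limits cancels.
  refine tendsto_nhds_unique ((tendsto_add_atTop_iff_nat 1).2 h2) (h3.congr fun n => ?_)
  have hQ := hs.aeval_Q_ne_zero hs0 n
  have hP : aeval z (P s (n + 1)) ≠ 0 := fun h => hz (im_eq_zero_of_aeval_P hp hs0 h)
  have h4 := quadrature_resolvent hp hs0 (n := n + 1) n.succ_pos (z := z) fun j _ => hne _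
  rw [Pi.div_apply, eq_neg_of_add_eq_zero_left h4]
  field_simp

theorem IsFriedrichs.unique {ν₁ ν₂ : Measure ℝ} (h1 : IsFriedrichs s ν₁)
    (h2 : IsFriedrichs s ν₂) : ν₁ = ν₂ := by
  have := h1.1.isFiniteMeasure
  have := h2.1.isFiniteMeasure
  refine measure_ext_of_stieltjes (by rw [h1.1.real_univ, h2.1.real_univ]) fun z hz => ?_
  rw [h1.2 z hz, h2.2 z hz]

theorem IndetS.support_friedrichs (hs : IndetS s) (hs0 : s 0 = 1) :
    (friedrichs s).support = Set.range (xi s) := by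
  obtain ⟨v, hv⟩ := hs.exists_dominated hs0
  have hcl := hs.isClosed_range_xi hs0
  -- The atoms form a closed set, so passing to the support adds no points; each atom lies in it
  -- because its mass is positive.
  refine Set.Subset.antisymm (Measure.support_subset_of_isClosed hcl ?_) ?_
  · rw [mem_ae_iff, friedrichs, Measure.sum_apply _ hcl.measurableSet.compl]
    refine ENNReal.tsum_eq_zero.2 fun j => ?_
    rw [Measure.smul_apply, Measure.dirac_apply' _ hcl.measurableSet.compl]
    simp
  · rintro _ ⟨j, rfl⟩
    rw [Measure.mem_support_iff_forall]
    intro U hU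
    have h1 : ENNReal.ofReal (mass s j) ≤ friedrichs s U := by
      refine le_trans ?_ (Measure.le_sum_apply _ U)
      refine le_trans ?_ (ENNReal.le_tsum j)
      rw [Measure.smul_apply, Measure.dirac_apply_of_mem (mem_of_mem_nhds hU)]
      simp
    exact (ENNReal.ofReal_pos.2 (hv.mass_pos hs0 j)).trans_le h1

end StieltjesMoment

theorem mainTheorem2 (s : ℕ → ℝ) (hs0 : s 0 = 1) (hs : StieltjesMoment.IndetS s) :
    -- the series and limits that define the objects converge
    (∀ z : ℂ, (Summable fun k : ℕ => ‖aeval z (StieltjesMoment.P s k)‖ ^ 2) ∧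
      Summable fun k : ℕ => ‖aeval z (StieltjesMoment.Q s k)‖ ^ 2) ∧
    Tendsto (fun n : ℕ => (StieltjesMoment.P s n).eval 0 / (StieltjesMoment.Q s n).eval 0)
      atTop (𝓝 (StieltjesMoment.alpha s)) ∧
    Tendsto (fun x : ℝ => StieltjesMoment.nevD s x / StieltjesMoment.nevB s x)
      atBot (𝓝 (StieltjesMoment.alpha s : ℂ)) ∧
    (∀ k : ℕ, Tendsto (fun n : ℕ => StieltjesMoment.polyZero s n k) atTop
      (𝓝 (StieltjesMoment.xi s k))) ∧
    -- `0 < ξ_1 < ξ_2 < …`, tending to infinity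
    0 < StieltjesMoment.xi s 0 ∧ StrictMono (StieltjesMoment.xi s) ∧
    Tendsto (StieltjesMoment.xi s) atTop atTop ∧
    -- the `ξ_k` are exactly the zeros of the entire function `B(z) α(s) - D(z)`
    Differentiable ℂ (fun z : ℂ =>
      StieltjesMoment.nevB s z * StieltjesMoment.alpha s - StieltjesMoment.nevD s z) ∧
    {z : ℂ | StieltjesMoment.nevB s z * StieltjesMoment.alpha s - StieltjesMoment.nevD s z = 0} =
      Set.range (fun k : ℕ => (StieltjesMoment.xi s k : ℂ)) ∧
    -- the Friedrichs solution exists, is unique, and has support `{ξ_k}`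
    (∃! ν : Measure ℝ, StieltjesMoment.IsFriedrichs s ν) ∧
    ∀ ν : Measure ℝ, StieltjesMoment.IsFriedrichs s ν →
      ν.support = Set.range (StieltjesMoment.xi s) := by
  obtain ⟨v, hv⟩ := hs.exists_dominated hs0
  refine ⟨fun z => ⟨hv.domBy_P.summable_norm_sq hv.2.1 z, hv.domBy_Q.summable_norm_sq hv.2.1 z⟩,
    hs.tendsto_alpha hs0, hs.tendsto_nevD_div_nevB hs0, hs.tendsto_polyZero hs0,
    hs.xi_pos hs0 0, hs.strictMono_xi hs0, hs.tendsto_xi hs0,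
    (hv.differentiable_nevB.mul_const _).sub hv.differentiable_nevD, hs.setOf_nev_eq hs0,
    ⟨StieltjesMoment.friedrichs s, hs.isFriedrichs_friedrichs hs0,
      fun ν hν => hν.unique (hs.isFriedrichs_friedrichs hs0)⟩, fun ν hν => ?_⟩
  rw [hν.unique (hs.isFriedrichs_friedrichs hs0)]
  exact hs.support_friedrichs hs0
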